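/- \textbf{Setting.} Let $d\in\mathbb N$, let $\alpha>1/2$, and let $\gamma=(\gamma_u)_{u}$ be weights indexed by the finite subsets $u$ of $\mathbb N$, with $0<\gamma_u\le 1$. For $h\in\mathbb Z^d$ put $\operatorname{supp}(h)=\{j: h_j\ne 0\}$ and $$r_{d,\alpha,\gamma}(h)=\gamma_{\operatorname{supp}(h)}^{-1}\prod_{j\in\operatorname{supp}(h)}|h_j|^{\alpha},\qquad V_d(\alpha',\gamma')=\sum_{h\in\mathbb Z^d\setminus\{0\}}\frac1{r_{d,\alpha',\gamma'}(h)}\quad(\alpha'>1),$$ and $\gamma^{t}=(\gamma_u^{t})_u$. The Korobov class $\mathcal H_{d,\alpha,\gamma}$ consists of the functions $f\colon[0,1]^d\to\mathbb C$ that are everywhere equal to the sum of their absolutely convergent Fourier series $\sum_{h\in\mathbb Z^d}\hat f(h)e^{2\pi i h\cdot x}$ and satisfy $\|f\|_{d,\alpha,\gamma}:=\big(\sum_{h}r_{d,\alpha,\gamma}(h)^2|\hat f(h)|^2\big)^{1/2}<\infty$. Write $I_d(f)=\int_{[0,1]^d}f(x)\,dx$. For a prime $p$ and $z\in\{1,\dots,p-1\}^d$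 let $Q_p^z(f)=\frac1p\sum_{k=0}^{p-1}f(\{kz/p\})$, where $\{\cdot\}$ is the componentwise fractional part, and let $$e^{\det}_{d,\alpha,\gamma}(Q_p^z)=\sup\{|I_d(f)-Q_p^z(f)|: f\in\mathcal H_{d,\alpha,\gamma},\ \|f\|_{d,\alpha,\gamma}\le1\}.$$ For $\tau\in(0,1)$ and a prime $p$, call $Z\subseteq\{1,\dots,p-1\}^d$ a \emph{good set} if $|Z|\ge\lceil\tau(p-1)^d\rceil$ and every $z\in Z$ satisfies $$e^{\det}_{d,\alpha,\gamma}(Q_p^z)\le\inf_{1/2\le\lambda<\alpha}\Big(\frac{2}{(1-\tau)(p-1)}V_d\big(\alpha/\lambda,\gamma^{1/\lambda}\big)\Big)^{\lambda}.$$ For an integer $n\ge2$ let $\mathcal P_n$ be the (non-empty) set of primes $p$ with $\lceil n/2\rceil+1\le p\le n$. \textbf{Proposition.} For all $d$, $\alpha>1/2$, $\gamma$, $\tau\in(0,1)$ and all primes $p$ as above, a good set exists. Moreover, for every $\lambda>1/2$, $\delta\in(0,\min\{\lambda-1/2,1\})$ and $\tau\in(0,1)$ there is a constant $C_{\lambda,\delta,\tau}>0$,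 depending only on $\lambda,\delta,\tau$, such that the following holds for every $d$, every $\alpha>\lambda$, every $\gamma$ as above, and every choice of good sets $Z_{p,\tau}=Z_{p,\tau}(\alpha,\gamma,d)$, one for each prime $p$. If $p$ is uniformly distributed on $\mathcal P_n$ and, given $p$, $z$ is uniformly distributed on $Z_{p,\tau}$, then $$\mathbb E\,\big|I_d(f)-Q_p^z(f)\big|\le C_{\lambda,\delta,\tau}\,V_d\big(\alpha/\lambda,\gamma^{1/\lambda}\big)^{\lambda}\,n^{-\lambda-1/2+\delta}\,\|f\|_{d,\alpha,\gamma}$$ for all $f\in\mathcal H_{d,\alpha,\gamma}$ and all integers $n\ge2$ with $n\ge 4V_d(\alpha/\lambda,\gamma^{1/\lambda})/(1-\tau)$. -/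

import Mathlib

open MeasureTheory

noncomputable section

namespace Korobov

/-- The unit cube `[0,1]^d`. -/
def cube (d : ℕ) : Set (Fin d → ℝ) := Set.Icc 0 1

/-- `I_d(f)`, the integral of `f` over the unit cube with respect to Lebesgue measure. -/
def integral {d : ℕ} (f : (Fin d → ℝ) → ℂ) : ℂ := ∫ x in cube d, f x

/-- The character `x ↦ exp(2πi h·x)`. -/
def character {d : ℕ} (h : Fin d → ℤ) (x : Fin d → ℝ) : ℂ :=
  Complex.exp (2 * Real.pi * Complex.I * ((∑ j, (h j : ℝ) * x j : ℝ) : ℂ))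

/-- The `h`-th Fourier coefficient `∫_{[0,1]^d} f(x) exp(-2πi h·x) dx`. -/
def fourierCoefficient {d : ℕ} (f : (Fin d → ℝ) → ℂ) (h : Fin d → ℤ) : ℂ :=
  ∫ x in cube d, f x * character (-h) x

/-- The support `{j ∈ {1,…,d} : h_j ≠ 0}` as a finite set of positive integers
(coordinates are indexed from `1`). -/
def supp {d : ℕ} (h : Fin d → ℤ) : Finset ℕ :=
  (Finset.univ.filter fun j => h j ≠ 0).image fun j : Fin d => (j : ℕ) + 1

/-- `r_{d,α,γ}(h) = γ_{supp h}⁻¹ ∏_{j ∈ supp h} |h_j|^α`. -/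
def r {d : ℕ} (α : ℝ) (γ : Finset ℕ → ℝ) (h : Fin d → ℤ) : ℝ :=
  (γ (supp h))⁻¹ * ∏ j ∈ Finset.univ.filter (fun j => h j ≠ 0), |(h j : ℝ)| ^ α

/-- Membership in the weighted Korobov class: on the cube `f` is the sum of its (absolutely
convergent) Fourier series, and its Korobov norm is finite. Unconditional summability in `ℂ`
is the same as absolute summability. -/
def MemClass {d : ℕ} (α : ℝ) (γ : Finset ℕ → ℝ) (f : (Fin d → ℝ) → ℂ) : Prop :=
  (∀ x ∈ cube d, HasSum (fun h : Fin d → ℤ => fourierCoefficient f h * character h x) (f x)) ∧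
    Summable fun h : Fin d → ℤ => r α γ h ^ 2 * ‖fourierCoefficient f h‖ ^ 2

/-- The norm `(∑_h r(h)² |f̂(h)|²)^{1/2}` of the weighted Korobov class. -/
def korobovNorm {d : ℕ} (α : ℝ) (γ : Finset ℕ → ℝ) (f : (Fin d → ℝ) → ℂ) : ℝ :=
  Real.sqrt (∑' h : Fin d → ℤ, r α γ h ^ 2 * ‖fourierCoefficient f h‖ ^ 2)

/-- `V_d(α,γ) = ∑_{h ∈ ℤ^d \ {0}} 1 / r_{d,α,γ}(h)`. -/
def V (d : ℕ) (α : ℝ) (γ : Finset ℕ → ℝ) : ℝ :=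
  ∑' h : {h : Fin d → ℤ // h ≠ 0}, 1 / r α γ h.1

/-- The weights `γ^t = (γ_u^t)_u`. -/
def weightPow (γ : Finset ℕ → ℝ) (t : ℝ) : Finset ℕ → ℝ := fun u => γ u ^ t

/-- The lattice rule `Q_p^z(f) = p⁻¹ ∑_{k=0}^{p-1} f({kz/p})`. -/
def latticeRule {d : ℕ} (p : ℕ) (z : Fin d → ℕ) (f : (Fin d → ℝ) → ℂ) : ℂ :=
  (1 / (p : ℂ)) *
    ∑ k ∈ Finset.range p, f fun j => Int.fract ((k : ℝ) * (z j : ℝ) / (p : ℝ))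

/-- The worst-case error of `Q_p^z` on the unit ball of the weighted Korobov class. -/
def worstCaseError {d : ℕ} (α : ℝ) (γ : Finset ℕ → ℝ) (p : ℕ) (z : Fin d → ℕ) : ℝ :=
  sSup {e : ℝ | ∃ f : (Fin d → ℝ) → ℂ, MemClass α γ f ∧ korobovNorm α γ f ≤ 1 ∧
    e = ‖integral f - latticeRule p z f‖}

/-- The set `{1,…,p-1}^d` of all generating vectors. -/
def generators (d p : ℕ) : Finset (Fin d → ℕ) :=
  Fintype.piFinset fun _ => Finset.Icc 1 (p - 1)

/-- `Z` is a set of good generating vectors of relative size at least `τ`: it is a subset of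
`{1,…,p-1}^d` with at least `⌈τ (p-1)^d⌉` elements, all of which satisfy
`e(Q_p^z) ≤ inf_{1/2 ≤ lam < α} (2 / ((1-τ)(p-1)) · V_d(α/lam, γ^{1/lam}))^lam`. -/
structure IsGoodSet {d : ℕ} (α : ℝ) (γ : Finset ℕ → ℝ) (τ : ℝ) (p : ℕ)
    (Z : Finset (Fin d → ℕ)) : Prop where
  subset : Z ⊆ generators d p
  card_le : ⌈τ * ((p : ℝ) - 1) ^ d⌉₊ ≤ Z.card
  error_le : ∀ z ∈ Z, worstCaseError α γ p z ≤
    ⨅ lam : Set.Ico (1 / 2 : ℝ) α,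
      (2 / ((1 - τ) * ((p : ℝ) - 1)) *
        V d (α / (lam : ℝ)) (weightPow γ (1 / (lam : ℝ)))) ^ (lam : ℝ)

/-- The set `𝒫_n` of primes `p` with `⌈n/2⌉ + 1 ≤ p ≤ n`. -/
def primeRange (n : ℕ) : Finset ℕ :=
  (Finset.Icc (⌈(n : ℝ) / 2⌉₊ + 1) n).filter Nat.Prime

/-- `𝔼 |I_d(f) - Q_p^z(f)|`, where `p` is uniform on `𝒫_n` and, given `p`, the vector `z` is
uniform on `Z p`. -/
def expectedError {d : ℕ} (n : ℕ) (Z : ℕ → Finset (Fin d → ℕ)) (f : (Fin d → ℝ) → ℂ) : ℝ :=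
  (1 / ((primeRange n).card : ℝ)) * ∑ p ∈ primeRange n,
    (1 / ((Z p).card : ℝ)) * ∑ z ∈ Z p, ‖integral f - latticeRule p z f‖

end Korobov

end

/-! The error of `Q_p^z` is minus the sum of the Fourier coefficients over the nonzero `h` with `p ∣
h·z`. Averaging over `p` and `z` replaces the indicator of this set by a probability `dualProb n Z
h`, and Cauchy–Schwarz bounds the expected error by the norm of `f` times the `ℓ²` norm of `dualProb
/ r`. Two facts control that quotient. The probability is small (`dualProb_le`): if `h j ≠ 0`, few
primes divide `h j` compared with the `c n^(1-ε)` primes available, and for every other prime at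
most a fraction `1/(τ(p-1))` of the good `z` satisfies the congruence. It also vanishes unless `r`
is large (`IsGoodSet.one_div_r_le`): the rescaled character at a dual frequency lies in the unit
ball and has error `1/r`, so the worst-case bound for good vectors applies to it. With `s =
r^(1/lam)`, a factor `s^(-1/2)` of the quotient is kept, since its squares sum to `V`; the rest is
bounded by a power of `V/n`. Good sets exist by averaging over all `z` and Markov's inequality, for
each `lam` separately; the sets obtained are nested, so a smallest one serves all `lam` at once. -/

namespace Korobov

/-! ### Lower bound for the number of primes in `primeRange n` -/

/-- The primes in `(m, 2m]`. -/
def bertrandPrimes (m : ℕ) : Finset ℕ := (Finset.Ioc m (2 * m)).filter Nat.Prime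

/-- Erdős's factorization: every prime power in the central binomial coefficient is at most `2m`,
primes above `√(2m)` occur at most once, and none lies in `(2m/3, m]`. The three factors bound the
primes up to `√(2m)`, those up to `2m/3` (by a primorial), and those above `m`. -/
theorem centralBinom_le_bertrandPrimes (m : ℕ) (hm : 2 < m) :
    m.centralBinom ≤
      (2 * m) ^ Nat.sqrt (2 * m) * 4 ^ (2 * m / 3) * (2 * m) ^ (bertrandPrimes m).card := by
  have hm0 : 0 < m := by omega
  let f : ℕ → ℕ := fun x => x ^ m.centralBinom.factorization x
  have hf : ∀ p, f p ≤ 2 * m := fun p => Nat.pow_factorization_choose_le (by omega)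
  let S := (Finset.range (2 * m / 3 + 1)).filter Nat.Prime
  have hsplit : m.centralBinom = ∏ p ∈ S ∪ bertrandPrimes m, f p := by
    rw [← m.prod_pow_factorization_centralBinom]
    symm
    refine Finset.prod_subset ?_ ?_
    · intro x hx
      simp only [S, bertrandPrimes, Finset.mem_union, Finset.mem_filter, Finset.mem_range,
        Finset.mem_Ioc] at hx ⊢
      omega
    · intro x hx hx'
      simp only [S, bertrandPrimes, Finset.mem_union, Finset.mem_filter, Finset.mem_range,
        Finset.mem_Ioc, not_or, not_and'] at hx hx'
      by_cases hp : x.Prime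
      · have h1 := hx'.1 hp
        have h2 := hx'.2 hp
        have : m.centralBinom.factorization x = 0 :=
          Nat.factorization_centralBinom_of_two_mul_self_lt_three_mul hm (by omega) (by omega)
        simp [f, this]
      · simp [f, Nat.factorization_eq_zero_of_not_prime _ hp]
  have hdisj : Disjoint S (bertrandPrimes m) := by
    rw [Finset.disjoint_left]
    intro x hx hx'
    simp only [S, bertrandPrimes, Finset.mem_filter, Finset.mem_range, Finset.mem_Ioc] at hx hx'
    omega
  rw [hsplit, Finset.prod_union hdisj,
    ← Finset.prod_filter_mul_prod_filter_not S (· ≤ Nat.sqrt (2 * m))]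
  refine mul_le_mul' (mul_le_mul' ?_ ?_) (Finset.prod_le_pow_card _ _ _ fun p _ => hf p)
  · refine (Finset.prod_le_pow_card _ _ _ fun p _ => hf p).trans ?_
    have : (Finset.Icc 1 (Nat.sqrt (2 * m))).card = Nat.sqrt (2 * m) := by
      rw [Nat.card_Icc, Nat.add_sub_cancel]
    refine pow_right_mono₀ (by omega) ((Finset.card_le_card fun x hx => ?_).trans this.le)
    obtain ⟨h1, h2⟩ := Finset.mem_filter.1 hx
    exact Finset.mem_Icc.mpr ⟨(Finset.mem_filter.1 h1).2.one_lt.le, h2⟩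
  · refine le_trans ?_ (primorial_le_four_pow (2 * m / 3))
    refine (Finset.prod_le_prod' fun p hp => (?_ : f p ≤ p)).trans ?_
    · obtain ⟨h1, h2⟩ := Finset.mem_filter.1 hp
      refine (pow_right_mono₀ (Finset.mem_filter.1 h1).2.one_lt.le ?_).trans (pow_one p).le
      exact Nat.factorization_choose_le_one (Nat.sqrt_lt'.mp <| not_le.1 h2)
    refine Finset.prod_le_prod_of_subset_of_one_le' (Finset.filter_subset _ _) ?_
    exact fun p hp _ => (Finset.mem_filter.1 hp).2.one_lt.le

theorem card_bertrandPrimes_mul_log_ge (m : ℕ) (hm : 4 ≤ m) :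
    (2 * m : ℝ) / 6 - (1 + √(2 * m)) * Real.log (2 * m) ≤
      (bertrandPrimes m).card * Real.log (2 * m) := by
  have h1 : 4 ^ m ≤ m * ((2 * m) ^ Nat.sqrt (2 * m) * 4 ^ (2 * m / 3) *
      (2 * m) ^ (bertrandPrimes m).card) :=
    (Nat.four_pow_lt_mul_centralBinom m hm).le.trans
      (Nat.mul_le_mul_left _ (centralBinom_le_bertrandPrimes m (by omega)))
  have hm' : (4 : ℝ) ≤ m := by exact_mod_cast hm
  have h2 : (4 : ℝ) ^ m ≤ m * ((2 * m) ^ Nat.sqrt (2 * m) * 4 ^ (2 * m / 3) *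
      (2 * m) ^ (bertrandPrimes m).card) := by exact_mod_cast h1
  have h3 := Real.log_le_log (by positivity) h2
  rw [Real.log_mul (by positivity) (by positivity), Real.log_mul (by positivity) (by positivity),
    Real.log_mul (by positivity) (by positivity), Real.log_pow, Real.log_pow, Real.log_pow,
    Real.log_pow] at h3
  have hlog : Real.log m ≤ Real.log (2 * m) := Real.log_le_log (by positivity) (by linarith)
  have hpos : 0 ≤ Real.log (2 * m) := Real.log_nonneg (by linarith)
  have hsq : ((Nat.sqrt (2 * m) : ℕ) : ℝ) ≤ √(2 * m) := by
    have := @Real.nat_sqrt_le_real_sqrt (2 * m)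
    simpa using this
  have hdiv : (((2 * m / 3 : ℕ)) : ℝ) ≤ 2 * m / 3 := by
    have := @Nat.cast_div_le ℝ _ _ _ (2 * m) 3
    simpa using this
  have hl4 : 1 ≤ Real.log 4 := by
    have : Real.log 4 = 2 * Real.log 2 := by
      rw [show (4 : ℝ) = 2 ^ 2 by norm_num, Real.log_pow]; norm_num
    have := Real.log_two_gt_d9
    linarith
  have e1 := mul_le_mul_of_nonneg_right hsq hpos
  have e2 := mul_le_mul_of_nonneg_right hdiv (by linarith : 0 ≤ Real.log 4)
  have e3 : (m : ℝ) / 3 * 1 ≤ m / 3 * Real.log 4 := by gcongr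
  linarith

open Filter Asymptotics in
theorem eventually_sqrt_mul_log_le :
    ∀ᶠ x : ℝ in atTop, (1 + √x) * Real.log x ≤ x / 12 := by
  have h : (fun x : ℝ => Real.log x) =o[atTop] fun x : ℝ => x ^ (1 / 2 : ℝ) :=
    isLittleO_log_rpow_atTop (by norm_num)
  have := h.bound (show (0 : ℝ) < 1 / 24 by norm_num)
  filter_upwards [this, eventually_ge_atTop 1] with x hx hx1
  have hl : 0 ≤ Real.log x := Real.log_nonneg hx1
  rw [← Real.sqrt_eq_rpow, Real.norm_of_nonneg hl, Real.norm_of_nonneg (Real.sqrt_nonneg x)] at hx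
  have hs : 1 ≤ √x := Real.one_le_sqrt.2 hx1
  have hss : √x * √x = x := Real.mul_self_sqrt (by linarith)
  calc (1 + √x) * Real.log x ≤ (√x + √x) * (1 / 24 * √x) := by gcongr
    _ = x / 12 := by linear_combination (1 / 12) * hss

theorem exists_card_bertrandPrimes_ge (ε : ℝ) (hε : 0 < ε) (hε1 : ε < 1) :
    ∃ c : ℝ, 0 < c ∧ ∀ m : ℕ, 1 ≤ m →
      c * (2 * m : ℝ) ^ (1 - ε) ≤ (bertrandPrimes m).card := by
  obtain ⟨x₀, hx₀⟩ := Filter.eventually_atTop.1 eventually_sqrt_mul_log_le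
  set N : ℝ := max x₀ 8
  have hN : 8 ≤ N := le_max_right _ _
  -- The first constant serves `2m ≥ N`; the second makes the left side at most `1` below `N`, where
  -- Bertrand's postulate suffices.
  refine ⟨min (ε / 12) (N ^ (-(1 - ε))), lt_min (by positivity) (by positivity), fun m hm => ?_⟩
  have hm1 : (1 : ℝ) ≤ m := by exact_mod_cast hm
  rcases le_or_gt N (2 * m) with h | h
  · have h4 : 4 ≤ m := by
      have : (4 : ℝ) ≤ m := by linarith
      exact_mod_cast this
    have h1 := card_bertrandPrimes_mul_log_ge m h4
    have h2 := hx₀ (2 * m) ((le_max_left _ _).trans h)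
    have h3 : Real.log (2 * m) ≤ (2 * m : ℝ) ^ ε / ε := Real.log_le_rpow_div (by positivity) hε
    have h5 : (2 * m : ℝ) / 12 ≤ (bertrandPrimes m).card * ((2 * m : ℝ) ^ ε / ε) := by
      have := mul_le_mul_of_nonneg_left h3 (Nat.cast_nonneg (α := ℝ) (bertrandPrimes m).card)
      linarith
    have hp : 0 < (2 * m : ℝ) ^ ε := by positivity
    calc min (ε / 12) (N ^ (-(1 - ε))) * (2 * m : ℝ) ^ (1 - ε)
        ≤ ε / 12 * (2 * m : ℝ) ^ (1 - ε) := by gcongr; exact min_le_left _ _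
      _ = ε / (2 * m : ℝ) ^ ε * ((2 * m) / 12) := by
          rw [Real.rpow_sub (by positivity), Real.rpow_one]; field_simp
      _ ≤ ε / (2 * m : ℝ) ^ ε * ((bertrandPrimes m).card * ((2 * m : ℝ) ^ ε / ε)) := by gcongr
      _ = (bertrandPrimes m).card := by field_simp
  · obtain ⟨p, hp, h1, h2⟩ := Nat.exists_prime_lt_and_le_two_mul m (by omega)
    have : 1 ≤ (bertrandPrimes m).card :=
      Finset.card_pos.2 ⟨p, by simp [bertrandPrimes, hp, h1, h2]⟩
    calc min (ε / 12) (N ^ (-(1 - ε))) * (2 * m : ℝ) ^ (1 - ε)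
        ≤ N ^ (-(1 - ε)) * N ^ (1 - ε) := by
          gcongr
          · exact min_le_right _ _
      _ = 1 := by rw [← Real.rpow_add (by linarith)]; simp
      _ ≤ (bertrandPrimes m).card := by exact_mod_cast this

theorem bertrandPrimes_subset_primeRange (n : ℕ) (hn : 2 ≤ n) :
    bertrandPrimes ((n + 1) / 2) ⊆ primeRange n := by
  intro p hp
  simp only [bertrandPrimes, primeRange, Finset.mem_filter, Finset.mem_Ioc, Finset.mem_Icc] at hp ⊢
  obtain ⟨⟨h1, h2⟩, hp⟩ := hp
  have h3 : ⌈(n : ℝ) / 2⌉₊ ≤ (n + 1) / 2 := by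
    rw [Nat.ceil_le, div_le_iff₀ (by norm_num)]
    have : n ≤ (n + 1) / 2 * 2 := by omega
    exact_mod_cast this
  refine ⟨⟨by omega, ?_⟩, hp⟩
  -- Only `p = n + 1` with `n` odd could exceed `n`, and this is an even number above `2`.
  by_contra hpn
  have hodd := hp.eq_two_or_odd
  omega

theorem exists_card_primeRange_ge (ε : ℝ) (hε : 0 < ε) (hε1 : ε < 1) :
    ∃ c : ℝ, 0 < c ∧ ∀ n : ℕ, 2 ≤ n → c * (n : ℝ) ^ (1 - ε) ≤ (primeRange n).card := by
  obtain ⟨c, hc, h⟩ := exists_card_bertrandPrimes_ge ε hε hε1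
  refine ⟨c, hc, fun n hn => ?_⟩
  have h1 : ((bertrandPrimes ((n + 1) / 2)).card : ℝ) ≤ (primeRange n).card := by
    exact_mod_cast Finset.card_le_card (bertrandPrimes_subset_primeRange n hn)
  refine le_trans ?_ ((h ((n + 1) / 2) (by omega)).trans h1)
  have h2 : (n : ℝ) ≤ 2 * ((n + 1) / 2 : ℕ) := by
    have : n ≤ 2 * ((n + 1) / 2) := by omega
    exact_mod_cast this
  gcongr

/-! ### Number of prime divisors -/

theorem two_pow_card_primeFactors_le {a : ℕ} (ha : a ≠ 0) : 2 ^ a.primeFactors.card ≤ a :=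
  (Finset.pow_card_le_prod _ _ _ fun _ hp => (Nat.prime_of_mem_primeFactors hp).two_le).trans
    (Nat.le_of_dvd (Nat.pos_of_ne_zero ha) (Nat.prod_primeFactors_dvd a))

theorem card_primeFactors_le_rpow {a : ℕ} (ha : a ≠ 0) {ε : ℝ} (hε : 0 < ε) :
    (a.primeFactors.card : ℝ) ≤ 2 / ε * (a : ℝ) ^ ε := by
  have h1 : ((2 : ℝ)) ^ a.primeFactors.card ≤ a := by
    exact_mod_cast two_pow_card_primeFactors_le ha
  have h2 := Real.log_le_log (by positivity) h1
  rw [Real.log_pow] at h2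
  have h3 : Real.log a ≤ (a : ℝ) ^ ε / ε := Real.log_le_rpow_div (by positivity) hε
  have h4 := Real.log_two_gt_d9
  have h5 : (a.primeFactors.card : ℝ) * (1 / 2) ≤ a.primeFactors.card * Real.log 2 := by
    gcongr; linarith
  have : 2 / ε * (a : ℝ) ^ ε = 2 * ((a : ℝ) ^ ε / ε) := by ring
  linarith

/-! ### Dual lattice and error expansion -/

variable {d : ℕ}

/-- The nonzero frequencies `h` with `h·z ≡ 0 (mod p)`. -/
def dual (p : ℕ) (z : Fin d → ℕ) : Set (Fin d → ℤ) :=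
  {h | h ≠ 0 ∧ (p : ℤ) ∣ ∑ j, h j * (z j : ℤ)}

theorem r_pos {α : ℝ} {γ : Finset ℕ → ℝ} (hγ : ∀ u, 0 < γ u) (h : Fin d → ℤ) : 0 < r α γ h := by
  refine mul_pos (inv_pos.2 (hγ _)) (Finset.prod_pos fun j hj => ?_)
  have : h j ≠ 0 := (Finset.mem_filter.1 hj).2
  positivity

theorem character_zero (x : Fin d → ℝ) : character 0 x = 1 := by
  simp [character]

theorem integral_eq_fourierCoefficient (f : (Fin d → ℝ) → ℂ) :
    integral f = fourierCoefficient f 0 := by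
  simp [integral, fourierCoefficient, character_zero]

theorem norm_character (h : Fin d → ℤ) (x : Fin d → ℝ) : ‖character h x‖ = 1 := by
  rw [character, show (2 * Real.pi * Complex.I * ((∑ j, (h j : ℝ) * x j : ℝ) : ℂ)) =
    ((2 * Real.pi * (∑ j, (h j : ℝ) * x j) : ℝ) : ℂ) * Complex.I by push_cast; ring,
    Complex.norm_exp_ofReal_mul_I]

theorem character_fract {p : ℕ} (hp : p ≠ 0) (z : Fin d → ℕ) (h : Fin d → ℤ) (k : ℕ) :
    character h (fun j => Int.fract ((k : ℝ) * (z j : ℝ) / (p : ℝ))) =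
      Complex.exp (2 * Real.pi * Complex.I * ((∑ j, h j * (z j : ℤ) : ℤ) / p : ℂ)) ^ k := by
  rw [character, ← Complex.exp_nat_mul, Complex.exp_eq_exp_iff_exists_int]
  -- Taking fractional parts changes the phase by the integer `h · ⌊kz/p⌋`.
  refine ⟨-∑ j, h j * ⌊(k : ℝ) * (z j : ℝ) / (p : ℝ)⌋, ?_⟩
  have hp' : (p : ℂ) ≠ 0 := by exact_mod_cast hp
  simp only [← Int.self_sub_floor]
  push_cast
  simp only [mul_sub, Finset.sum_sub_distrib, Finset.mul_sum, Finset.sum_div, Finset.sum_mul,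
    neg_mul, ← sub_eq_add_neg]
  congr 1
  · refine Finset.sum_congr rfl fun j _ => ?_
    ring
  · refine Finset.sum_congr rfl fun j _ => ?_
    ring

theorem latticeRule_character {p : ℕ} (hp : p ≠ 0) (z : Fin d → ℕ) (h : Fin d → ℤ) :
    latticeRule p z (character h) =
      if (p : ℤ) ∣ ∑ j, h j * (z j : ℤ) then 1 else 0 := by
  have hp' : (p : ℂ) ≠ 0 := by exact_mod_cast hp
  simp only [latticeRule, character_fract hp]
  set m : ℤ := ∑ j, h j * (z j : ℤ)
  set ζ := Complex.exp (2 * Real.pi * Complex.I * ((m : ℂ) / p)) with hζ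
  have hpi : 2 * (Real.pi : ℂ) * Complex.I ≠ 0 := Complex.two_pi_I_ne_zero
  split_ifs with hd
  · have : ζ = 1 := by
      obtain ⟨a, ha⟩ := hd
      rw [hζ, Complex.exp_eq_one_iff]
      refine ⟨a, ?_⟩
      rw [ha]; push_cast; field_simp
    simp [this, hp']
  · have h1 : ζ ≠ 1 := by
      intro h1
      rw [hζ, Complex.exp_eq_one_iff] at h1
      obtain ⟨a, ha⟩ := h1
      refine hd ⟨a, ?_⟩
      have h2 : (m : ℂ) / p = a := mul_left_cancel₀ hpi (by rw [ha]; ring)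
      rw [div_eq_iff hp'] at h2
      have h3 : (m : ℂ) = ((p : ℤ) * a : ℤ) := by rw [h2]; push_cast; ring
      exact_mod_cast h3
    have h2 : ζ ^ p = 1 := by
      rw [hζ, ← Complex.exp_nat_mul, Complex.exp_eq_one_iff]
      refine ⟨m, ?_⟩
      field_simp
    rw [geom_sum_eq h1, h2]
    simp

theorem fract_mem_cube (y : Fin d → ℝ) : (fun j => Int.fract (y j)) ∈ cube d :=
  ⟨fun _ => Int.fract_nonneg _, fun _ => (Int.fract_lt_one _).le⟩

theorem MemClass.summable_norm {α : ℝ} {γ : Finset ℕ → ℝ} {f : (Fin d → ℝ) → ℂ}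
    (hf : MemClass α γ f) : Summable fun h => ‖fourierCoefficient f h‖ := by
  have h0 := (hf.1 0 ⟨le_rfl, fun _ => zero_le_one⟩).summable.norm
  simpa [norm_character] using h0

theorem MemClass.hasSum_latticeRule {α : ℝ} {γ : Finset ℕ → ℝ} {f : (Fin d → ℝ) → ℂ}
    (hf : MemClass α γ f) {p : ℕ} (hp : p ≠ 0) (z : Fin d → ℕ) :
    HasSum (fun h => fourierCoefficient f h *
      if (p : ℤ) ∣ ∑ j, h j * (z j : ℤ) then 1 else 0) (latticeRule p z f) := by
  have h1 := (hasSum_sum (s := Finset.range p) fun k _ =>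
    hf.1 _ (fract_mem_cube fun j => (k : ℝ) * (z j : ℝ) / (p : ℝ))).mul_left (1 / (p : ℂ))
  refine h1.congr_fun ?_
  intro h
  rw [← latticeRule_character hp, latticeRule, ← Finset.mul_sum]
  ring

theorem MemClass.norm_error_le {α : ℝ} {γ : Finset ℕ → ℝ} {f : (Fin d → ℝ) → ℂ}
    (hf : MemClass α γ f) {p : ℕ} (hp : p ≠ 0) (z : Fin d → ℕ) :
    ‖integral f - latticeRule p z f‖ ≤
      ∑' h, ‖fourierCoefficient f h‖ * (dual p z).indicator 1 h := by
  classical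
  have h0 : HasSum (fun h : Fin d → ℤ => if h = 0 then fourierCoefficient f 0 else 0)
      (integral f) := by
    rw [integral_eq_fourierCoefficient]
    exact hasSum_ite_eq 0 _
  have h1 := h0.sub (hf.hasSum_latticeRule hp z)
  rw [← h1.tsum_eq]
  have hs : Summable fun h => ‖fourierCoefficient f h‖ * (dual p z).indicator 1 h := by
    refine hf.summable_norm.of_nonneg_of_le (fun h => ?_) fun h => ?_
    · exact mul_nonneg (norm_nonneg _) (Set.indicator_nonneg (fun _ _ => zero_le_one) _)
    · refine mul_le_of_le_one_right (norm_nonneg _) ?_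
      exact Set.indicator_le_self' (fun _ _ => zero_le_one) _
  refine tsum_of_norm_bounded hs.hasSum fun h => ?_
  by_cases hh : h = 0
  · subst hh; simp [dual]
  · by_cases hd : (p : ℤ) ∣ ∑ j, h j * (z j : ℤ)
    · have : h ∈ dual p z := ⟨hh, hd⟩
      simp [hh, hd, this]
    · have : h ∉ dual p z := fun h => hd h.2
      simp [hh, hd, this]

theorem tsum_mul_le_sqrt_mul_sqrt {ι : Type*} {a b : ι → ℝ} (ha : ∀ i, 0 ≤ a i)
    (hb : ∀ i, 0 ≤ b i) (hsa : Summable fun i => a i ^ 2) (hsb : Summable fun i => b i ^ 2) :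
    ∑' i, a i * b i ≤ √(∑' i, a i ^ 2) * √(∑' i, b i ^ 2) := by
  have := Real.inner_le_Lp_mul_Lq_tsum_of_nonneg Real.HolderConjugate.two_two ha hb
    (by simpa using hsa) (by simpa using hsb)
  simpa [Real.sqrt_eq_rpow] using this

/-- Cauchy–Schwarz with `r` shifted between the factors. It is applied with `w` the indicator of
`dual p z` for the worst-case error and with `w = dualProb n Z` for the expected error. -/
theorem MemClass.tsum_norm_mul_le {α : ℝ} {γ : Finset ℕ → ℝ} (hγ : ∀ u, 0 < γ u)
    {f : (Fin d → ℝ) → ℂ} (hf : MemClass α γ f) {w : (Fin d → ℤ) → ℝ} (hw : ∀ h, 0 ≤ w h)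
    (hs : Summable fun h => (w h / r α γ h) ^ 2) :
    ∑' h, ‖fourierCoefficient f h‖ * w h ≤ korobovNorm α γ f * √(∑' h, (w h / r α γ h) ^ 2) := by
  have h1 := tsum_mul_le_sqrt_mul_sqrt (a := fun h => r α γ h * ‖fourierCoefficient f h‖)
    (b := fun h => w h / r α γ h) (fun h => mul_nonneg (r_pos hγ h).le (norm_nonneg _))
    (fun h => div_nonneg (hw h) (r_pos hγ h).le) (by simpa only [mul_pow] using hf.2) hs
  simp only [mul_pow] at h1
  refine le_trans (le_of_eq (tsum_congr fun h => ?_)) h1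
  have := (r_pos (α := α) hγ h).ne'
  field_simp

/-! ### Characters as test functions, and the worst-case error -/

theorem setIntegral_exp_int (m : ℤ) :
    ∫ x in Set.Icc (0 : ℝ) 1, Complex.exp (2 * Real.pi * Complex.I * m * x) =
      if m = 0 then 1 else 0 := by
  rw [integral_Icc_eq_integral_Ioc, ← intervalIntegral.integral_of_le zero_le_one]
  split_ifs with hm
  · simp [hm]
  · have hm' : (m : ℂ) ≠ 0 := by exact_mod_cast hm
    rw [integral_exp_mul_complex (mul_ne_zero Complex.two_pi_I_ne_zero hm')]
    have : Complex.exp (2 * Real.pi * Complex.I * m * (1 : ℝ)) = 1 := by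
      rw [Complex.exp_eq_one_iff]; exact ⟨m, by push_cast; ring⟩
    rw [this]; simp

theorem character_eq_prod (h : Fin d → ℤ) (x : Fin d → ℝ) :
    character h x = ∏ j, Complex.exp (2 * Real.pi * Complex.I * h j * x j) := by
  rw [character, ← Complex.exp_sum]
  congr 1
  push_cast
  rw [Finset.mul_sum]
  exact Finset.sum_congr rfl fun j _ => by ring

theorem setIntegral_character (h : Fin d → ℤ) :
    ∫ x in cube d, character h x = if h = 0 then 1 else 0 := by
  have hc : cube d = Set.univ.pi fun _ : Fin d => Set.Icc (0 : ℝ) 1 := by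
    rw [Set.pi_univ_Icc]; rfl
  simp only [character_eq_prod]
  rw [hc, volume_pi, Measure.restrict_pi_pi, integral_fintype_prod_eq_prod
    (f := fun j (y : ℝ) => Complex.exp (2 * Real.pi * Complex.I * h j * y))]
  simp only [setIntegral_exp_int]
  split_ifs with h0
  · simp [h0]
  · obtain ⟨j, hj⟩ := Function.ne_iff.1 h0
    exact Finset.prod_eq_zero (Finset.mem_univ j) (by simpa using hj)

theorem character_mul (h h' : Fin d → ℤ) (x : Fin d → ℝ) :
    character h x * character h' x = character (h + h') x := by
  simp only [character, ← Complex.exp_add]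
  congr 1
  push_cast
  simp only [Pi.add_apply, Int.cast_add, add_mul, Finset.sum_add_distrib]
  ring

theorem fourierCoefficient_character (c : ℂ) (h₀ h : Fin d → ℤ) :
    fourierCoefficient (fun x => c * character h₀ x) h = if h = h₀ then c else 0 := by
  simp only [fourierCoefficient, mul_assoc, character_mul]
  rw [integral_const_mul, setIntegral_character]
  simp [add_neg_eq_zero, eq_comm]

theorem memClass_character (α : ℝ) (γ : Finset ℕ → ℝ) (c : ℂ) (h₀ : Fin d → ℤ) :
    MemClass α γ (fun x => c * character h₀ x) := by
  constructor
  · intro x _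
    have := hasSum_ite_eq h₀ (c * character h₀ x)
    refine this.congr_fun ?_
    intro h
    rw [fourierCoefficient_character]
    split_ifs with hh <;> simp [hh]
  · refine summable_of_ne_finset_zero (s := {h₀}) fun h hh => ?_
    rw [fourierCoefficient_character]
    simp [Finset.notMem_singleton.1 hh]

theorem korobovNorm_character {α : ℝ} {γ : Finset ℕ → ℝ} (hγ : ∀ u, 0 < γ u) (c : ℂ)
    (h₀ : Fin d → ℤ) : korobovNorm α γ (fun x => c * character h₀ x) = r α γ h₀ * ‖c‖ := by
  rw [korobovNorm, tsum_eq_single h₀, fourierCoefficient_character, if_pos rfl, ← mul_pow,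
    Real.sqrt_sq (mul_nonneg (r_pos hγ _).le (norm_nonneg _))]
  intro h hh
  rw [fourierCoefficient_character, if_neg hh]
  simp

/-- The errors on the unit ball, whose supremum is the worst-case error. -/
def errorSet (α : ℝ) (γ : Finset ℕ → ℝ) (p : ℕ) (z : Fin d → ℕ) : Set ℝ :=
  {e : ℝ | ∃ f : (Fin d → ℝ) → ℂ, MemClass α γ f ∧ korobovNorm α γ f ≤ 1 ∧
    e = ‖integral f - latticeRule p z f‖}

theorem errorSet_nonempty (α : ℝ) {γ : Finset ℕ → ℝ} (hγ : ∀ u, 0 < γ u) (p : ℕ)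
    (z : Fin d → ℕ) : (errorSet α γ p z).Nonempty :=
  ⟨_, _, memClass_character α γ 0 0, by rw [korobovNorm_character hγ]; simp, rfl⟩

theorem le_of_mem_errorSet {α : ℝ} {γ : Finset ℕ → ℝ} (hγ : ∀ u, 0 < γ u) {p : ℕ} (hp : p ≠ 0)
    {z : Fin d → ℕ} (hs : Summable fun h => ((dual p z).indicator 1 h / r α γ h) ^ 2)
    {e : ℝ} (he : e ∈ errorSet α γ p z) :
    e ≤ √(∑' h, ((dual p z).indicator 1 h / r α γ h) ^ 2) := by
  obtain ⟨f, hf, hn, rfl⟩ := he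
  refine (hf.norm_error_le hp z).trans ?_
  refine (hf.tsum_norm_mul_le hγ (fun h => Set.indicator_nonneg (fun _ _ => zero_le_one) _)
    hs).trans ?_
  exact mul_le_of_le_one_left (Real.sqrt_nonneg _) hn

theorem worstCaseError_le {α : ℝ} {γ : Finset ℕ → ℝ} (hγ : ∀ u, 0 < γ u) {p : ℕ} (hp : p ≠ 0)
    {z : Fin d → ℕ} (hs : Summable fun h => ((dual p z).indicator 1 h / r α γ h) ^ 2) :
    worstCaseError α γ p z ≤ √(∑' h, ((dual p z).indicator 1 h / r α γ h) ^ 2) :=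
  csSup_le (errorSet_nonempty α hγ p z) fun _ he => le_of_mem_errorSet hγ hp hs he

/-- The character divided by `r α γ h` has norm `1`, integral `0` and lattice average `1 / r α γ h`.
Summability is needed to bound the set of errors, so that `sSup` is a true supremum. -/
theorem one_div_r_le_worstCaseError {α : ℝ} {γ : Finset ℕ → ℝ} (hγ : ∀ u, 0 < γ u) {p : ℕ}
    (hp : p ≠ 0) {z : Fin d → ℕ}
    (hs : Summable fun h => ((dual p z).indicator 1 h / r α γ h) ^ 2) {h : Fin d → ℤ}
    (hh : h ∈ dual p z) : 1 / r α γ h ≤ worstCaseError α γ p z := by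
  have hr := r_pos (α := α) hγ h
  refine le_csSup ⟨_, fun _ he => le_of_mem_errorSet hγ hp hs he⟩
    ⟨fun x => ((1 / r α γ h : ℝ) : ℂ) * character h x, memClass_character _ _ _ _, ?_, ?_⟩
  · rw [korobovNorm_character hγ, Complex.norm_real, Real.norm_of_nonneg (by positivity)]
    field_simp
    exact le_rfl
  · have h1 : latticeRule p z (fun x => ((1 / r α γ h : ℝ) : ℂ) * character h x) =
        ((1 / r α γ h : ℝ) : ℂ) * latticeRule p z (character h) := by
      simp only [latticeRule, ← Finset.mul_sum]; ring
    rw [h1, latticeRule_character hp, if_pos hh.2, integral_eq_fourierCoefficient,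
      fourierCoefficient_character, if_neg hh.1.symm, zero_sub, mul_one, norm_neg,
      Complex.norm_real, Real.norm_of_nonneg (by positivity)]

/-! ### Powers of `r` and summability of `1 / r` -/

theorem r_rpow {α : ℝ} {γ : Finset ℕ → ℝ} (hγ : ∀ u, 0 < γ u) (t : ℝ) (h : Fin d → ℤ) :
    r (α * t) (weightPow γ t) h = r α γ h ^ t := by
  have h1 : ∀ j, 0 ≤ |(h j : ℝ)| ^ α := fun j => Real.rpow_nonneg (abs_nonneg _) _
  rw [r, r, Real.mul_rpow (inv_nonneg.2 (hγ _).le) (Finset.prod_nonneg fun j _ => h1 j),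
    ← Real.finsetProd_rpow _ _ fun j _ => h1 j, Real.inv_rpow (hγ _).le, weightPow]
  congr 1
  exact Finset.prod_congr rfl fun j _ => Real.rpow_mul (abs_nonneg _) _ _

theorem weightPow_pos {γ : Finset ℕ → ℝ} (hγ : ∀ u, 0 < γ u) (t : ℝ) (u : Finset ℕ) :
    0 < weightPow γ t u := Real.rpow_pos_of_pos (hγ u) t

theorem weightPow_le_one {γ : Finset ℕ → ℝ} (hγ : ∀ u, 0 < γ u ∧ γ u ≤ 1) {t : ℝ} (ht : 0 ≤ t)
    (u : Finset ℕ) : weightPow γ t u ≤ 1 := Real.rpow_le_one (hγ u).1.le (hγ u).2 ht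

theorem summable_prod_apply {ρ : ℤ → ℝ} (hρ : ∀ m, 0 ≤ ρ m) (hs : Summable ρ) :
    Summable fun h : Fin d → ℤ => ∏ j, ρ (h j) := by
  classical
  refine summable_of_sum_le (c := (∑' m, ρ m) ^ d)
    (fun h => Finset.prod_nonneg fun j _ => hρ _) fun s => ?_
  calc ∑ h ∈ s, ∏ j, ρ (h j)
      ≤ ∑ h ∈ Fintype.piFinset fun j => s.image fun h => h j, ∏ j, ρ (h j) := by
        refine Finset.sum_le_sum_of_subset_of_nonneg (fun h hh => ?_)
          fun h _ _ => Finset.prod_nonneg fun j _ => hρ _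
        exact Fintype.mem_piFinset.2 fun j => Finset.mem_image_of_mem _ hh
    _ = ∏ j, ∑ m ∈ s.image fun h => h j, ρ m := (Finset.prod_univ_sum _ _).symm
    _ ≤ ∏ _j : Fin d, ∑' m, ρ m := by
        refine Finset.prod_le_prod (fun j _ => Finset.sum_nonneg fun m _ => hρ m) fun j _ => ?_
        exact hs.sum_le_tsum _ fun m _ => hρ m
    _ = (∑' m, ρ m) ^ d := by simp

theorem summable_one_div_r {α : ℝ} (hα : 1 < α) {γ : Finset ℕ → ℝ}
    (hγ : ∀ u, 0 < γ u ∧ γ u ≤ 1) : Summable fun h : Fin d → ℤ => 1 / r α γ h := by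
  let ρ : ℤ → ℝ := fun m => if m = 0 then 1 else |(m : ℝ)| ^ (-α)
  have hρ : Summable ρ := by
    refine (Real.summable_abs_int_rpow hα).congr_cofinite ?_
    filter_upwards [(Set.finite_singleton (0 : ℤ)).compl_mem_cofinite] with m hm
    have : m ≠ 0 := by simpa using hm
    simp [ρ, this]
  refine (summable_prod_apply (d := d) (fun m => ?_) hρ).of_nonneg_of_le
    (fun h => one_div_nonneg.2 (r_pos (fun u => (hγ u).1) h).le) fun h => ?_
  · dsimp only [ρ]; split_ifs <;> positivity
  · have h1 : 0 ≤ ∏ j ∈ Finset.univ.filter fun j => h j ≠ 0, (|(h j : ℝ)| ^ α)⁻¹ :=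
      Finset.prod_nonneg fun j _ => by positivity
    have h2 : ∏ j, ρ (h j) = ∏ j ∈ Finset.univ.filter fun j => h j ≠ 0, (|(h j : ℝ)| ^ α)⁻¹ := by
      rw [Finset.prod_filter]
      refine Finset.prod_congr rfl fun j _ => ?_
      by_cases hj : h j = 0
      · simp [ρ, hj]
      · simp [ρ, hj, Real.rpow_neg]
    rw [h2, r, one_div, mul_inv, inv_inv, ← Finset.prod_inv_distrib]
    exact mul_le_of_le_one_left h1 (hγ _).2

theorem V_eq_tsum_indicator (α : ℝ) (γ : Finset ℕ → ℝ) :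
    V d α γ = ∑' h : Fin d → ℤ, Set.indicator {h | h ≠ 0} (fun h => 1 / r α γ h) h :=
  tsum_subtype {h : Fin d → ℤ | h ≠ 0} fun h => 1 / r α γ h

theorem V_nonneg {α : ℝ} {γ : Finset ℕ → ℝ} (hγ : ∀ u, 0 < γ u) : 0 ≤ V d α γ :=
  tsum_nonneg fun h => one_div_nonneg.2 (r_pos hγ h.1).le

theorem mul_r_le_r_smul {α : ℝ} (hα : 1 ≤ α) {γ : Finset ℕ → ℝ} (hγ : ∀ u, 0 < γ u) {p : ℕ}
    (hp : 1 ≤ p) {h : Fin d → ℤ} (hh : h ≠ 0) : p * r α γ h ≤ r α γ fun j => p * h j := by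
  have hp0 : (p : ℤ) ≠ 0 := by positivity
  have hp1 : (1 : ℝ) ≤ p := by exact_mod_cast hp
  have hf : (Finset.univ.filter fun j => (p : ℤ) * h j ≠ 0) =
      Finset.univ.filter fun j => h j ≠ 0 := by
    ext j; simp [show p ≠ 0 by omega]
  have hsupp : supp (fun j => (p : ℤ) * h j) = supp h := by rw [supp, supp, hf]
  have hr := r_pos (α := α) hγ h
  have hne : (Finset.univ.filter fun j => h j ≠ 0).card ≠ 0 := by
    obtain ⟨j, hj⟩ := Function.ne_iff.1 hh
    exact (Finset.card_pos.2 ⟨j, by simpa using hj⟩).ne'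
  have key : r α γ (fun j => (p : ℤ) * h j) =
      ((p : ℝ) ^ α) ^ (Finset.univ.filter fun j => h j ≠ 0).card * r α γ h := by
    rw [r, hsupp, hf, r]
    have : ∀ j, |(((p : ℤ) * h j : ℤ) : ℝ)| ^ α = (p : ℝ) ^ α * |(h j : ℝ)| ^ α := fun j => by
      rw [Int.cast_mul, abs_mul, Real.mul_rpow (abs_nonneg _) (abs_nonneg _)]
      simp
    simp only [this, Finset.prod_mul_distrib, Finset.prod_const]
    ring
  rw [key]
  gcongr
  have h1 : (p : ℝ) ≤ (p : ℝ) ^ α := Real.self_le_rpow_of_one_le hp1 hα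
  exact h1.trans (le_self_pow₀ (hp1.trans h1) hne)

/-! ### Averaging over all generating vectors -/

/-- The nonzero frequencies all of whose components are divisible by `p`. -/
def multiples (d p : ℕ) : Set (Fin d → ℤ) := {h | h ≠ 0 ∧ ∀ j, (p : ℤ) ∣ h j}

theorem tsum_multiples_le {α : ℝ} (hα : 1 < α) {γ : Finset ℕ → ℝ}
    (hγ : ∀ u, 0 < γ u ∧ γ u ≤ 1) {p : ℕ} (hp : 1 ≤ p) :
    ∑' h, (multiples d p).indicator (fun h => 1 / r α γ h) h ≤ V d α γ / p := by
  have hγ0 := fun u => (hγ u).1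
  have hp0 : (p : ℤ) ≠ 0 := by positivity
  have hinj : Function.Injective fun (h : Fin d → ℤ) j => (p : ℤ) * h j := by
    intro a b hab
    funext j
    exact mul_left_cancel₀ hp0 (congrFun hab j)
  have hsupp : Function.support ((multiples d p).indicator fun h => 1 / r α γ h) ⊆
      Set.range fun (h : Fin d → ℤ) j => (p : ℤ) * h j := by
    refine Set.support_indicator_subset.trans fun h hh => ?_
    choose a ha using hh.2
    exact ⟨a, by funext j; rw [ha]⟩
  have hs := (summable_one_div_r (d := d) hα hγ)
  rw [← hinj.tsum_eq hsupp, V_eq_tsum_indicator, ← tsum_div_const]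
  refine Summable.tsum_le_tsum (fun h => ?_) ((hs.indicator _).comp_injective hinj)
    ((hs.indicator _).div_const _)
  by_cases hh : h = 0
  · subst hh
    have : (fun j => (p : ℤ) * (0 : Fin d → ℤ) j) ∉ multiples d p := fun h => h.1 (by ext; simp)
    rw [Set.indicator_of_notMem this]
    simp
  · rw [Set.indicator_of_mem (s := {h : Fin d → ℤ | h ≠ 0}) hh, div_div]
    refine (Set.indicator_le_self' (fun _ _ => one_div_nonneg.2 (r_pos hγ0 _).le) _).trans ?_
    refine one_div_le_one_div_of_le (mul_pos (r_pos hγ0 _) (by positivity)) ?_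
    rw [mul_comm]
    exact mul_r_le_r_smul hα.le hγ0 hp hh

-- Since `h j` is invertible modulo `p`, the other coordinates of `z` determine `z j`. Overwriting
-- `z j` by an arbitrary `a` is therefore injective on pairs `(z, a)`.
open Classical in
theorem card_filter_dual_le {p : ℕ} (hp : p.Prime) {h : Fin d → ℤ}
    (hh : ∃ j, ¬ (p : ℤ) ∣ h j) :
    ((generators d p).filter fun z => h ∈ dual p z).card * (p - 1) ≤ (p - 1) ^ d := by
  obtain ⟨j, hj⟩ := hh
  have hcard : (generators d p).card = (p - 1) ^ d := by simp [generators]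
  rw [← hcard]
  conv_lhs => rw [show p - 1 = (Finset.Icc 1 (p - 1)).card by simp]
  rw [← Finset.card_product]
  refine Finset.card_le_card_of_injOn (fun q => Function.update q.1 j q.2) ?_ ?_
  · rintro ⟨z, a⟩ hq
    simp only [Finset.coe_product, Set.mem_prod, Finset.mem_coe, Finset.mem_filter, generators,
      Fintype.mem_piFinset] at hq ⊢
    intro i
    by_cases hi : i = j
    · subst hi; simpa using hq.2
    · simpa [hi] using hq.1.1 i
  · rintro ⟨z, a⟩ hq ⟨z', a'⟩ hq' heq
    simp only [Finset.coe_product, Set.mem_prod, Finset.mem_coe, Finset.mem_filter, generators,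
      Fintype.mem_piFinset] at hq hq' heq
    have ha : a = a' := by simpa using congrFun heq j
    have hz : ∀ i, i ≠ j → z i = z' i := fun i hi => by simpa [hi] using congrFun heq i
    refine Prod.ext (funext fun i => ?_) ha
    by_cases hi : i = j
    · subst hi
      have hd := dvd_sub hq.1.2.2 hq'.1.2.2
      rw [← Finset.sum_sub_distrib, Finset.sum_eq_single i (fun k _ hk => by rw [hz k hk, sub_self])
        (fun h => absurd (Finset.mem_univ _) h), ← mul_sub] at hd
      have hd' := ((Nat.prime_iff_prime_int.1 hp).dvd_or_dvd hd).resolve_left hj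
      have b1 := Finset.mem_Icc.1 (hq.1.1 i)
      have b2 := Finset.mem_Icc.1 (hq'.1.1 i)
      have := Int.eq_zero_of_abs_lt_dvd hd' (abs_lt.2 ⟨by omega, by omega⟩)
      simp only
      omega
    · exact hz i hi

-- The factor `2` collects two contributions: frequencies that are not multiples of `p` are dual for
-- a fraction at most `1/(p-1)` of the `z`, while multiples of `p` may be dual for all `z` but carry
-- total mass at most `V/p`.
open Classical in
theorem sum_generators_tsum_dual_le {α : ℝ} (hα : 1 < α) {γ : Finset ℕ → ℝ}
    (hγ : ∀ u, 0 < γ u ∧ γ u ≤ 1) {p : ℕ} (hp : p.Prime) :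
    ∑ z ∈ generators d p, ∑' h, (dual p z).indicator (fun h => 1 / r α γ h) h ≤
      ((p : ℝ) - 1) ^ d * (2 / ((p : ℝ) - 1) * V d α γ) := by
  have hγ0 := fun u => (hγ u).1
  have hs := summable_one_div_r (d := d) hα hγ
  have hp2 : (2 : ℝ) ≤ p := by exact_mod_cast hp.two_le
  have hp1 : (0 : ℝ) < p - 1 := by linarith
  have hc : (((p - 1 : ℕ)) : ℝ) = p - 1 := by rw [Nat.cast_sub hp.one_le, Nat.cast_one]
  set N : ℝ := ((p : ℝ) - 1) ^ d with hN
  have hN0 : 0 < N := by positivity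
  have hV := V_nonneg (d := d) (α := α) hγ0
  rw [← Summable.tsum_finsetSum fun z _ => hs.indicator _]
  have hbound : ∀ h : Fin d → ℤ, ∑ z ∈ generators d p, (dual p z).indicator (fun h => 1 / r α γ h) h
      ≤ N / (p - 1) * Set.indicator {h | h ≠ 0} (fun h => 1 / r α γ h) h +
        N * (multiples d p).indicator (fun h => 1 / r α γ h) h := by
    intro h
    have hr : 0 ≤ 1 / r α γ h := one_div_nonneg.2 (r_pos hγ0 h).le
    have e : ∑ z ∈ generators d p, (dual p z).indicator (fun h => 1 / r α γ h) h =
        ((generators d p).filter fun z => h ∈ dual p z).card * (1 / r α γ h) := by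
      simp only [Set.indicator_apply]
      rw [← Finset.sum_filter, Finset.sum_const, nsmul_eq_mul]
    rw [e]
    by_cases h0 : h = 0
    · subst h0; simp [dual, multiples]
    · rw [Set.indicator_of_mem (s := {h : Fin d → ℤ | h ≠ 0}) h0]
      by_cases hm : ∀ j, (p : ℤ) ∣ h j
      · rw [Set.indicator_of_mem (s := multiples d p) ⟨h0, hm⟩]
        have : (((generators d p).filter fun z => h ∈ dual p z).card : ℝ) ≤ N := by
          have h1 := Finset.card_filter_le (generators d p) fun z => h ∈ dual p z
          have h2 : (generators d p).card = (p - 1) ^ d := by simp [generators]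
          rw [h2] at h1
          rw [hN, ← hc]; exact_mod_cast h1
        have h3 := mul_le_mul_of_nonneg_right this hr
        have : 0 ≤ N / (p - 1) * (1 / r α γ h) := by positivity
        linarith
      · rw [Set.indicator_of_notMem (s := multiples d p) fun h => hm h.2, mul_zero, add_zero]
        refine mul_le_mul_of_nonneg_right ?_ hr
        rw [le_div_iff₀ hp1, hN, ← hc]
        exact_mod_cast card_filter_dual_le hp (not_forall.1 hm)
  refine (Summable.tsum_le_tsum hbound (summable_sum fun z _ => hs.indicator _)
    (((hs.indicator _).mul_left _).add ((hs.indicator _).mul_left _))).trans ?_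
  rw [Summable.tsum_add ((hs.indicator _).mul_left _) ((hs.indicator _).mul_left _), tsum_mul_left,
    tsum_mul_left, ← V_eq_tsum_indicator]
  have h1 := tsum_multiples_le (d := d) hα hγ hp.one_le
  have h2 : V d α γ / p ≤ V d α γ / (p - 1) := by gcongr; linarith
  have h3 := mul_le_mul_of_nonneg_left (h1.trans h2) hN0.le
  calc _ ≤ N / (p - 1) * V d α γ + N * (V d α γ / (p - 1)) := by linarith
    _ = _ := by ring

/-! ### Existence of good sets -/

theorem rpow_eq_mul_rpow_sub_one {x q : ℝ} (hx : 0 ≤ x) (hq : 1 ≤ q) :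
    x ^ q = x * x ^ (q - 1) := by
  rcases hx.eq_or_lt with h | h
  · rw [← h, Real.zero_rpow (by linarith), zero_mul]
  · rw [Real.rpow_sub h, Real.rpow_one]; field_simp

theorem summable_rpow_and_tsum_rpow_le {ι : Type*} {a : ι → ℝ} (ha : ∀ i, 0 ≤ a i)
    (hs : Summable a) {q : ℝ} (hq : 1 ≤ q) :
    (Summable fun i => a i ^ q) ∧ ∑' i, a i ^ q ≤ (∑' i, a i) ^ q := by
  have hA : 0 ≤ ∑' i, a i := tsum_nonneg ha
  have h1 : ∀ i, a i ^ q ≤ a i * (∑' i, a i) ^ (q - 1) := fun i => by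
    rw [rpow_eq_mul_rpow_sub_one (ha i) hq]
    exact mul_le_mul_of_nonneg_left (Real.rpow_le_rpow (ha i)
      (hs.le_tsum i fun j _ => ha j) (by linarith)) (ha i)
  have hs' : Summable fun i => a i ^ q :=
    (hs.mul_right _).of_nonneg_of_le (fun i => Real.rpow_nonneg (ha i) _) h1
  refine ⟨hs', (hs'.tsum_le_tsum h1 (hs.mul_right _)).trans_eq ?_⟩
  rw [tsum_mul_right, ← rpow_eq_mul_rpow_sub_one hA hq]

theorem one_lt_div_of_lt {lam α : ℝ} (hl : 1 / 2 ≤ lam) (hlα : lam < α) : 1 < α / lam :=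
  (one_lt_div (by linarith)).2 hlα

theorem indicator_div_r_sq {α : ℝ} {γ : Finset ℕ → ℝ} (hγ : ∀ u, 0 < γ u) {lam : ℝ}
    (hl : 1 / 2 ≤ lam) (p : ℕ) (z : Fin d → ℕ) (h : Fin d → ℤ) :
    ((dual p z).indicator 1 h / r α γ h) ^ 2 =
      (dual p z).indicator (fun h => 1 / r (α / lam) (weightPow γ (1 / lam)) h) h ^ (2 * lam) := by
  by_cases hh : h ∈ dual p z
  · have hr := r_pos (α := α) hγ h
    rw [Set.indicator_of_mem hh, Set.indicator_of_mem hh, div_eq_mul_one_div α lam, r_rpow hγ,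
      one_div (r α γ h ^ _), Real.inv_rpow (by positivity), ← Real.rpow_mul hr.le,
      show 1 / lam * (2 * lam) = (2 : ℕ) by field_simp; norm_num, Real.rpow_natCast]
    simp
  · rw [Set.indicator_of_notMem hh, Set.indicator_of_notMem hh, Real.zero_rpow (by linarith)]
    simp

theorem summable_one_div_r_weightPow {α lam : ℝ} {γ : Finset ℕ → ℝ} (hl : 1 / 2 ≤ lam)
    (hlα : lam < α) (hγ : ∀ u, 0 < γ u ∧ γ u ≤ 1) :
    Summable fun h : Fin d → ℤ => 1 / r (α / lam) (weightPow γ (1 / lam)) h :=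
  summable_one_div_r (one_lt_div_of_lt hl hlα) fun u =>
    ⟨weightPow_pos (fun u => (hγ u).1) _ u,
      weightPow_le_one hγ (one_div_nonneg.2 (by linarith)) u⟩

/-- Write `r⁻²` as the power `2 * lam` of `r^(-1/lam)` and use that the `ℓ^q` norm is at most the
`ℓ¹` norm for `q = 2 * lam ≥ 1`. -/
theorem summable_and_tsum_dual_sq_le {α lam : ℝ} {γ : Finset ℕ → ℝ} (hl : 1 / 2 ≤ lam)
    (hlα : lam < α) (hγ : ∀ u, 0 < γ u ∧ γ u ≤ 1)
    (p : ℕ) (z : Fin d → ℕ) :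
    (Summable fun h => ((dual p z).indicator 1 h / r α γ h) ^ 2) ∧
      ∑' h, ((dual p z).indicator 1 h / r α γ h) ^ 2 ≤
        (∑' h, (dual p z).indicator
          (fun h => 1 / r (α / lam) (weightPow γ (1 / lam)) h) h) ^ (2 * lam) := by
  simp only [indicator_div_r_sq (fun u => (hγ u).1) hl]
  refine summable_rpow_and_tsum_rpow_le (fun h => ?_)
    ((summable_one_div_r_weightPow hl hlα hγ).indicator _) (by linarith)
  exact Set.indicator_nonneg (fun h _ =>
    one_div_nonneg.2 (r_pos (weightPow_pos (fun u => (hγ u).1) _) h).le) _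

theorem worstCaseError_le_rpow {α lam : ℝ} {γ : Finset ℕ → ℝ} (hl : 1 / 2 ≤ lam)
    (hlα : lam < α) (hγ : ∀ u, 0 < γ u ∧ γ u ≤ 1)
    (p : ℕ) (z : Fin d → ℕ) (hp : p ≠ 0) :
    worstCaseError α γ p z ≤ (∑' h, (dual p z).indicator
      (fun h => 1 / r (α / lam) (weightPow γ (1 / lam)) h) h) ^ lam := by
  have h0 : 0 ≤ ∑' h, (dual p z).indicator
      (fun h => 1 / r (α / lam) (weightPow γ (1 / lam)) h) h :=
    tsum_nonneg fun h => Set.indicator_nonneg (fun h _ =>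
      one_div_nonneg.2 (r_pos (weightPow_pos (fun u => (hγ u).1) _) h).le) _
  obtain ⟨h1, h2⟩ := summable_and_tsum_dual_sq_le hl hlα hγ p z
  refine (worstCaseError_le (fun u => (hγ u).1) hp h1).trans ?_
  refine (Real.sqrt_le_sqrt h2).trans_eq ?_
  rw [mul_comm, Real.rpow_mul h0, Real.rpow_two, Real.sqrt_sq (Real.rpow_nonneg h0 _)]

/-- Markov's inequality: more than `(1 - τ) * s.card` indices above the threshold would already
exceed the total. -/
theorem card_filter_le_of_sum_le {ι : Type*} (s : Finset ι) {S : ι → ℝ} (hS : ∀ i, 0 ≤ S i)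
    {A τ : ℝ} (hA : 0 ≤ A) (hτ : τ < 1) (hs : s.Nonempty) (hsum : ∑ i ∈ s, S i ≤ s.card * A) :
    τ * s.card ≤ (s.filter fun i => S i ≤ A / (1 - τ)).card := by
  have h1τ : 0 < 1 - τ := by linarith
  by_contra! hlt
  set g := s.filter fun i => S i ≤ A / (1 - τ)
  set b := s.filter fun i => ¬ S i ≤ A / (1 - τ)
  have hgb : (g.card : ℝ) + b.card = s.card := by
    exact_mod_cast Finset.card_filter_add_card_filter_not _
  have hsp : 0 < (s.card : ℝ) := by exact_mod_cast hs.card_pos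
  have hb : (1 - τ) * s.card < b.card := by linarith
  have hbn : b.Nonempty := Finset.card_pos.1 (by
    have : (0 : ℝ) < b.card := by nlinarith
    exact_mod_cast this)
  have h2 : b.card * (A / (1 - τ)) < ∑ i ∈ b, S i := by
    rw [← nsmul_eq_mul, ← Finset.sum_const]
    exact Finset.sum_lt_sum_of_nonempty hbn fun i hi => not_le.1 (Finset.mem_filter.1 hi).2
  have h3 : ∑ i ∈ b, S i ≤ ∑ i ∈ s, S i :=
    Finset.sum_le_sum_of_subset_of_nonneg (Finset.filter_subset _ _) fun i _ _ => hS i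
  have h4 : (1 - τ) * s.card * (A / (1 - τ)) ≤ b.card * (A / (1 - τ)) := by gcongr
  have h5 : (1 - τ) * s.card * (A / (1 - τ)) = s.card * A := by field_simp
  linarith

theorem exists_isGoodSet (d : ℕ) {α : ℝ} {γ : Finset ℕ → ℝ} {τ : ℝ} {p : ℕ} (hα : 1 / 2 < α)
    (hγ : ∀ u, 0 < γ u ∧ γ u ≤ 1) (hτ : τ < 1) (hp : p.Prime) :
    ∃ Z : Finset (Fin d → ℕ), IsGoodSet α γ τ p Z := by
  have hγ0 := fun u => (hγ u).1
  have hp2 : (2 : ℝ) ≤ p := by exact_mod_cast hp.two_le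
  have hp1 : (0 : ℝ) < p - 1 := by linarith
  have hc : (((p - 1 : ℕ)) : ℝ) = p - 1 := by rw [Nat.cast_sub hp.one_le, Nat.cast_one]
  have hcard : ((generators d p).card : ℝ) = (p - 1) ^ d := by simp [generators, hc]
  have hne : (generators d p).Nonempty := Finset.card_pos.1 (by
    have : (0 : ℝ) < (generators d p).card := by rw [hcard]; positivity
    exact_mod_cast this)
  let b : Set.Ico (1 / 2 : ℝ) α → ℝ := fun lam =>
    (2 / ((1 - τ) * ((p : ℝ) - 1)) *
      V d (α / (lam : ℝ)) (weightPow γ (1 / (lam : ℝ)))) ^ (lam : ℝ)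
  let G : Set.Ico (1 / 2 : ℝ) α → Finset (Fin d → ℕ) := fun lam =>
    (generators d p).filter fun z => worstCaseError α γ p z ≤ b lam
  have : Nonempty (Set.Ico (1 / 2 : ℝ) α) := ⟨⟨1 / 2, le_rfl, hα⟩⟩
  have hG : ∀ lam, ⌈τ * ((p : ℝ) - 1) ^ d⌉₊ ≤ (G lam).card := by
    rintro ⟨lam, hl, hlα⟩
    have hw := weightPow_pos hγ0 (1 / lam)
    let S : (Fin d → ℕ) → ℝ := fun z => ∑' h, (dual p z).indicator
      (fun h => 1 / r (α / lam) (weightPow γ (1 / lam)) h) h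
    have hS : ∀ z, 0 ≤ S z := fun z => tsum_nonneg fun h =>
      Set.indicator_nonneg (fun h _ => one_div_nonneg.2 (r_pos hw h).le) _
    have hsum := sum_generators_tsum_dual_le (d := d) (one_lt_div_of_lt hl hlα)
      (fun u => ⟨hw u, weightPow_le_one hγ (one_div_nonneg.2 (by linarith)) u⟩) hp
    rw [← hcard] at hsum ⊢
    rw [Nat.ceil_le]
    refine (card_filter_le_of_sum_le (generators d p) hS
      (mul_nonneg (by positivity) (V_nonneg hw)) hτ hne hsum).trans ?_
    refine Nat.cast_le.2 (Finset.card_le_card fun z hz => ?_)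
    rw [Finset.mem_filter] at hz ⊢
    refine ⟨hz.1, (worstCaseError_le_rpow hl hlα hγ p z hp.ne_zero).trans ?_⟩
    refine Real.rpow_le_rpow (hS z) (hz.2.trans_eq ?_) (by linarith)
    have : (1 - τ) ≠ 0 := by linarith
    field_simp
  -- The infimum of `b` need not be attained, but the sublevel sets `G lam` are nested and finite,
  -- so one of least cardinality is contained in all of them.
  obtain ⟨l₀, hl₀⟩ : ∃ l₀, ∀ lam, (G l₀).card ≤ (G lam).card := by
    obtain ⟨l₀, -, h⟩ := WellFounded.has_min (measure fun lam => (G lam).card).wf Set.univ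
      Set.univ_nonempty
    exact ⟨l₀, fun lam => not_lt.1 (h lam trivial)⟩
  refine ⟨G l₀, Finset.filter_subset _ _, hG l₀, fun z hz => le_ciInf fun lam => ?_⟩
  rcases le_total (b l₀) (b lam) with h | h
  · exact (Finset.mem_filter.1 hz).2.trans h
  · have hsub : G lam ⊆ G l₀ := fun x hx => by
      rw [Finset.mem_filter] at hx ⊢
      exact ⟨hx.1, hx.2.trans h⟩
    rw [← Finset.eq_of_subset_of_card_le hsub (hl₀ lam)] at hz
    exact (Finset.mem_filter.1 hz).2

/-! ### Probability that a frequency is dual -/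

/-- The 0-1 vector supported on `supp h` contributes exactly `γ (supp h)` to `V`. This absorbs the
weight in `r` without a constant depending on `d` or `γ`. -/
theorem abs_le_V_mul_r {α : ℝ} (hα : 1 < α) {γ : Finset ℕ → ℝ} (hγ : ∀ u, 0 < γ u ∧ γ u ≤ 1)
    {h : Fin d → ℤ} {j : Fin d} (hj : h j ≠ 0) : |(h j : ℝ)| ≤ V d α γ * r α γ h := by
  have hγ0 := fun u => (hγ u).1
  let e : Fin d → ℤ := fun i => if h i ≠ 0 then 1 else 0
  have hfe : (Finset.univ.filter fun i => e i ≠ 0) = Finset.univ.filter fun i => h i ≠ 0 := by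
    ext i; simp [e]
  have he0 : e ≠ 0 := Function.ne_iff.2 ⟨j, by simp [e, hj]⟩
  have hre : r α γ e = (γ (supp h))⁻¹ := by
    have h1 : supp e = supp h := by rw [supp, supp, hfe]
    rw [r, h1, hfe, Finset.prod_eq_one, mul_one]
    intro i hi
    simp [e, (Finset.mem_filter.1 hi).2]
  have hV : γ (supp h) ≤ V d α γ := by
    have hs : Summable fun h : {h : Fin d → ℤ // h ≠ 0} => 1 / r α γ h.1 :=
      (summable_one_div_r hα hγ).comp_injective Subtype.val_injective
    have := hs.le_tsum ⟨e, he0⟩ fun i _ => one_div_nonneg.2 (r_pos hγ0 i.1).le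
    rwa [hre, one_div, inv_inv] at this
  have habs : ∀ i, h i ≠ 0 → (1 : ℝ) ≤ |(h i : ℝ)| := fun i hi => by
    exact_mod_cast Int.one_le_abs hi
  have hprod : |(h j : ℝ)| ≤ ∏ i ∈ Finset.univ.filter fun i => h i ≠ 0, |(h i : ℝ)| ^ α := by
    refine (Real.self_le_rpow_of_one_le (habs j hj) hα.le).trans ?_
    rw [← Finset.mul_prod_erase _ _ (show j ∈ Finset.univ.filter fun i => h i ≠ 0 by simpa using hj)]
    refine le_mul_of_one_le_right (by positivity) ?_
    refine Finset.one_le_prod fun i hi => ?_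
    exact Real.one_le_rpow (habs i (Finset.mem_filter.1 (Finset.mem_of_mem_erase hi)).2)
      (by linarith)
  calc |(h j : ℝ)| ≤ ∏ i ∈ Finset.univ.filter fun i => h i ≠ 0, |(h i : ℝ)| ^ α := hprod
    _ = γ (supp h) * r α γ h := by rw [r, mul_inv_cancel_left₀ (hγ0 _).ne']
    _ ≤ V d α γ * r α γ h := by gcongr; exact (r_pos hγ0 h).le

/-- The probability that `h` is a nonzero frequency of the dual lattice of the random rule. -/
noncomputable def dualProb (n : ℕ) (Z : ℕ → Finset (Fin d → ℕ)) (h : Fin d → ℤ) : ℝ :=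
  (1 / ((primeRange n).card : ℝ)) * ∑ p ∈ primeRange n,
    (1 / ((Z p).card : ℝ)) * ∑ z ∈ Z p, (dual p z).indicator 1 h

theorem indicator_dual_nonneg (p : ℕ) (z : Fin d → ℕ) (h : Fin d → ℤ) :
    (0 : ℝ) ≤ (dual p z).indicator 1 h :=
  Set.indicator_nonneg (fun _ _ => zero_le_one) _

theorem indicator_dual_le_one (p : ℕ) (z : Fin d → ℕ) (h : Fin d → ℤ) :
    (dual p z).indicator 1 h ≤ (1 : ℝ) :=
  Set.indicator_le_self' (fun _ _ => zero_le_one) _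

theorem dualProb_nonneg (n : ℕ) (Z : ℕ → Finset (Fin d → ℕ)) (h : Fin d → ℤ) :
    0 ≤ dualProb n Z h :=
  mul_nonneg (by positivity) (Finset.sum_nonneg fun p _ => mul_nonneg (by positivity)
    (Finset.sum_nonneg fun z _ => indicator_dual_nonneg p z h))

theorem prime_of_mem_primeRange {n p : ℕ} (hp : p ∈ primeRange n) : p.Prime :=
  (Finset.mem_filter.1 hp).2

theorem half_le_of_mem_primeRange {n p : ℕ} (hp : p ∈ primeRange n) : (n : ℝ) / 2 ≤ p - 1 := by
  have h1 := (Finset.mem_Icc.1 (Finset.mem_filter.1 hp).1).1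
  have h2 : ((⌈(n : ℝ) / 2⌉₊ + 1 : ℕ) : ℝ) ≤ p := by exact_mod_cast h1
  have h3 := Nat.le_ceil ((n : ℝ) / 2)
  push_cast at h2
  linarith

theorem MemClass.expectedError_le {α : ℝ} {γ : Finset ℕ → ℝ} {f : (Fin d → ℝ) → ℂ}
    (hf : MemClass α γ f) (n : ℕ) (Z : ℕ → Finset (Fin d → ℕ)) :
    expectedError n Z f ≤ ∑' h, ‖fourierCoefficient f h‖ * dualProb n Z h := by
  have hs : ∀ p z, Summable fun h => ‖fourierCoefficient f h‖ * (dual p z).indicator 1 h :=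
    fun p z => hf.summable_norm.of_nonneg_of_le
      (fun h => mul_nonneg (norm_nonneg _) (indicator_dual_nonneg p z h))
      fun h => mul_le_of_le_one_right (norm_nonneg _) (indicator_dual_le_one p z h)
  have e : ∀ h, ‖fourierCoefficient f h‖ * dualProb n Z h =
      (1 / ((primeRange n).card : ℝ)) * ∑ p ∈ primeRange n,
        (1 / ((Z p).card : ℝ)) * ∑ z ∈ Z p,
          ‖fourierCoefficient f h‖ * (dual p z).indicator 1 h := by
    intro h
    simp only [dualProb, Finset.mul_sum]
    refine Finset.sum_congr rfl fun p _ => Finset.sum_congr rfl fun z _ => ?_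
    ring
  simp only [e]
  rw [tsum_mul_left, Summable.tsum_finsetSum fun p _ =>
    (summable_sum fun z _ => hs p z).mul_left _, expectedError]
  refine mul_le_mul_of_nonneg_left (Finset.sum_le_sum fun p hp => ?_) (by positivity)
  rw [tsum_mul_left, Summable.tsum_finsetSum fun z _ => hs p z]
  refine mul_le_mul_of_nonneg_left (Finset.sum_le_sum fun z _ => ?_) (by positivity)
  exact hf.norm_error_le (prime_of_mem_primeRange hp).ne_zero z

-- If `p ∤ h j`, passing from all generating vectors to a subset of density at least `τ` costs at
-- most a factor `1/τ`.
open Classical in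
theorem IsGoodSet.mean_indicator_dual_le {α : ℝ} {γ : Finset ℕ → ℝ} {τ : ℝ} (hτ : 0 < τ) {p : ℕ}
    (hp : p.Prime) {Z : Finset (Fin d → ℕ)} (hZ : IsGoodSet α γ τ p Z) (h : Fin d → ℤ)
    (j : Fin d) : (1 / (Z.card : ℝ)) * ∑ z ∈ Z, (dual p z).indicator 1 h ≤
      (if (p : ℤ) ∣ h j then 1 else 0) + 1 / (τ * ((p : ℝ) - 1)) := by
  have hp2 : (2 : ℝ) ≤ p := by exact_mod_cast hp.two_le
  have hp1 : (0 : ℝ) < p - 1 := by linarith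
  have hc : (((p - 1 : ℕ)) : ℝ) = p - 1 := by rw [Nat.cast_sub hp.one_le, Nat.cast_one]
  have hZc : τ * ((p : ℝ) - 1) ^ d ≤ Z.card := Nat.ceil_le.1 hZ.card_le
  have hZ0 : (0 : ℝ) < Z.card := lt_of_lt_of_le (by positivity) hZc
  split_ifs with hd
  · have h1 : ∑ z ∈ Z, (dual p z).indicator (1 : (Fin d → ℤ) → ℝ) h ≤ Z.card := by
      have := Finset.sum_le_card_nsmul Z (fun z => (dual p z).indicator (1 : (Fin d → ℤ) → ℝ) h) 1
        fun z _ => indicator_dual_le_one p z h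
      simpa using this
    have h2 : (1 / (Z.card : ℝ)) * ∑ z ∈ Z, (dual p z).indicator 1 h ≤ 1 := by
      rw [one_div_mul_eq_div, div_le_one hZ0]; exact h1
    have : 0 ≤ 1 / (τ * ((p : ℝ) - 1)) := by positivity
    linarith
  · rw [zero_add]
    have h1 : ∑ z ∈ Z, (dual p z).indicator (1 : (Fin d → ℤ) → ℝ) h =
        (Z.filter fun z => h ∈ dual p z).card := by
      simp [Set.indicator_apply]
    have h2 : ((Z.filter fun z => h ∈ dual p z).card : ℝ) * (p - 1) ≤ (p - 1) ^ d := by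
      rw [← hc]
      exact_mod_cast (Nat.mul_le_mul_right _ (Finset.card_le_card
        (Finset.filter_subset_filter _ hZ.subset))).trans (card_filter_dual_le hp ⟨j, hd⟩)
    rw [h1, one_div_mul_eq_div, div_le_div_iff₀ hZ0 (by positivity)]
    nlinarith

theorem card_filter_dvd_le (n : ℕ) {a : ℤ} (ha : a ≠ 0) {ε : ℝ} (hε : 0 < ε) :
    (((primeRange n).filter fun p : ℕ => (p : ℤ) ∣ a).card : ℝ) ≤ 2 / ε * |(a : ℝ)| ^ ε := by
  have h0 : a.natAbs ≠ 0 := Int.natAbs_ne_zero.2 ha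
  have h1 : (primeRange n).filter (fun p : ℕ => (p : ℤ) ∣ a) ⊆ a.natAbs.primeFactors := by
    intro p hp
    rw [Finset.mem_filter] at hp
    exact Nat.mem_primeFactors.2 ⟨prime_of_mem_primeRange hp.1, Int.natCast_dvd.1 hp.2, h0⟩
  have h2 := card_primeFactors_le_rpow h0 hε
  rw [Nat.cast_natAbs, Int.cast_abs] at h2
  exact (Nat.cast_le.2 (Finset.card_le_card h1)).trans h2

theorem dualProb_le {α : ℝ} {γ : Finset ℕ → ℝ} {τ ε c : ℝ} (hτ : 0 < τ) (hε : 0 < ε)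
    (hc : 0 < c) {n : ℕ} (hn : 2 ≤ n) (hcard : c * (n : ℝ) ^ (1 - ε) ≤ (primeRange n).card)
    {Z : ℕ → Finset (Fin d → ℕ)} (hZ : ∀ p : ℕ, p.Prime → IsGoodSet α γ τ p (Z p))
    {h : Fin d → ℤ} {j : Fin d} (hj : h j ≠ 0) :
    dualProb n Z h ≤ (2 / (ε * c) + 2 / τ) * |(h j : ℝ)| ^ ε * (n : ℝ) ^ (ε - 1) := by
  have hn0 : (0 : ℝ) < n := by positivity
  have hn1 : (1 : ℝ) ≤ n := by exact_mod_cast (by omega : 1 ≤ n)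
  have hP : (0 : ℝ) < (primeRange n).card := lt_of_lt_of_le (by positivity) hcard
  have h1 : ∑ p ∈ primeRange n, (1 / ((Z p).card : ℝ)) * ∑ z ∈ Z p, (dual p z).indicator 1 h ≤
      ((primeRange n).filter fun p : ℕ => (p : ℤ) ∣ h j).card +
        (primeRange n).card * (2 / (τ * n)) := by
    refine (Finset.sum_le_sum (g := fun p : ℕ => (if (p : ℤ) ∣ h j then (1 : ℝ) else 0) +
      2 / (τ * n)) fun p hp => ?_).trans_eq ?_
    · refine ((hZ p (prime_of_mem_primeRange hp)).mean_indicator_dual_le hτ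
        (prime_of_mem_primeRange hp) h j).trans ?_
      have h2 := half_le_of_mem_primeRange hp
      have h3 : 1 / (τ * ((p : ℝ) - 1)) ≤ 1 / (τ * (n / 2)) := by gcongr
      have h4 : 1 / (τ * (n / 2)) = 2 / (τ * n) := by field_simp
      linarith
    · rw [Finset.sum_add_distrib]; simp
  have ha : (1 : ℝ) ≤ |(h j : ℝ)| := by exact_mod_cast Int.one_le_abs hj
  have hae : (1 : ℝ) ≤ |(h j : ℝ)| ^ ε := Real.one_le_rpow ha hε.le
  have hne : (1 : ℝ) ≤ (n : ℝ) ^ ε := Real.one_le_rpow hn1 hε.le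
  have hnn : (n : ℝ) ^ (ε - 1) = (n : ℝ) ^ ε / n := by rw [Real.rpow_sub hn0, Real.rpow_one]
  have hnn' : c * ((n : ℝ) / (n : ℝ) ^ ε) ≤ (primeRange n).card := by
    rwa [Real.rpow_sub hn0, Real.rpow_one] at hcard
  have hA := card_filter_dvd_le n hj hε
  have hnp : 0 < (n : ℝ) ^ ε := by linarith
  calc dualProb n Z h
      ≤ (1 / ((primeRange n).card : ℝ)) *
        (((primeRange n).filter fun p : ℕ => (p : ℤ) ∣ h j).card +
          (primeRange n).card * (2 / (τ * n))) := by rw [dualProb]; gcongr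
    _ = ((primeRange n).filter fun p : ℕ => (p : ℤ) ∣ h j).card / ((primeRange n).card : ℝ) +
          2 / (τ * n) := by field_simp
    _ ≤ (2 / ε * |(h j : ℝ)| ^ ε) / (c * ((n : ℝ) / (n : ℝ) ^ ε)) + 2 / (τ * n) * 1 := by
        rw [mul_one]; gcongr
    -- The second term is inflated by factors at least `1` to take the shape of the first.
    _ ≤ (2 / ε * |(h j : ℝ)| ^ ε) / (c * ((n : ℝ) / (n : ℝ) ^ ε)) +
          2 / (τ * n) * (|(h j : ℝ)| ^ ε * (n : ℝ) ^ ε) := by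
        gcongr; exact one_le_mul_of_one_le_of_one_le hae hne
    _ = _ := by rw [hnn]; field_simp

theorem IsGoodSet.one_div_r_le {α lam : ℝ} {γ : Finset ℕ → ℝ} {τ : ℝ} (hl : 1 / 2 ≤ lam)
    (hlα : lam < α) (hγ : ∀ u, 0 < γ u ∧ γ u ≤ 1) (hτ : τ < 1) {n p : ℕ} (hn : 2 ≤ n)
    (hp : p ∈ primeRange n) {Z : Finset (Fin d → ℕ)} (hZ : IsGoodSet α γ τ p Z)
    {z : Fin d → ℕ} (hz : z ∈ Z) {h : Fin d → ℤ} (hh : h ∈ dual p z) :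
    1 / r (α / lam) (weightPow γ (1 / lam)) h ≤
      4 / (1 - τ) * V d (α / lam) (weightPow γ (1 / lam)) / n := by
  have hγ0 := fun u => (hγ u).1
  have hl0 : 0 < lam := by linarith
  have hn0 : (0 : ℝ) < n := by positivity
  have h1τ : 0 < 1 - τ := by linarith
  have hp1 := half_le_of_mem_primeRange hp
  have hr := r_pos (α := α) hγ0 h
  have hV : 0 ≤ V d (α / lam) (weightPow γ (1 / lam)) := V_nonneg (weightPow_pos hγ0 _)
  have h1 : 1 / r α γ h ≤ worstCaseError α γ p z :=
    one_div_r_le_worstCaseError hγ0 (prime_of_mem_primeRange hp).ne_zero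
      (summable_and_tsum_dual_sq_le hl hlα hγ p z).1 hh
  -- A real `⨅` lies below its terms only for a family bounded below; here `0` is a bound.
  have hbdd : BddBelow (Set.range fun lam : Set.Ico (1 / 2 : ℝ) α =>
      (2 / ((1 - τ) * ((p : ℝ) - 1)) *
        V d (α / (lam : ℝ)) (weightPow γ (1 / (lam : ℝ)))) ^ (lam : ℝ)) := by
    refine ⟨0, ?_⟩
    rintro _ ⟨l, rfl⟩
    have : (0 : ℝ) ≤ p - 1 := le_trans (by positivity) hp1
    exact Real.rpow_nonneg (mul_nonneg (by positivity) (V_nonneg (weightPow_pos hγ0 _))) _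
  have h2 := (h1.trans (hZ.error_le z hz)).trans (ciInf_le hbdd ⟨lam, hl, hlα⟩)
  have h3 : 2 / ((1 - τ) * ((p : ℝ) - 1)) * V d (α / lam) (weightPow γ (1 / lam)) ≤
      4 / (1 - τ) * V d (α / lam) (weightPow γ (1 / lam)) / n := by
    calc _ ≤ 2 / ((1 - τ) * ((n : ℝ) / 2)) * V d (α / lam) (weightPow γ (1 / lam)) := by gcongr
      _ = _ := by field_simp; ring
  have hp0 : (0 : ℝ) ≤ p - 1 := le_trans (by positivity) hp1
  rw [div_eq_mul_one_div α lam, r_rpow hγ0, one_div (r α γ h ^ _), ← Real.inv_rpow hr.le,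
    ← div_eq_mul_one_div, ← one_div (r α γ h)]
  refine le_trans ?_ h3
  have h4 := (Real.rpow_inv_le_iff_of_pos (by positivity) (mul_nonneg (by positivity) hV) hl0).2 h2
  rwa [← one_div lam] at h4

/-! ### Bound for the expected error -/

theorem exists_mem_dual_of_dualProb_ne_zero {n : ℕ} {Z : ℕ → Finset (Fin d → ℕ)}
    {h : Fin d → ℤ} (hh : dualProb n Z h ≠ 0) :
    ∃ p ∈ primeRange n, ∃ z ∈ Z p, h ∈ dual p z := by
  obtain ⟨p, hp, hpn⟩ := Finset.exists_ne_zero_of_sum_ne_zero (right_ne_zero_of_mul hh)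
  obtain ⟨z, hz, hzn⟩ := Finset.exists_ne_zero_of_sum_ne_zero (right_ne_zero_of_mul hpn)
  exact ⟨p, hp, z, hz, Set.mem_of_indicator_ne_zero hzn⟩

theorem dualProb_div_r_sq_le {α lam : ℝ} {γ : Finset ℕ → ℝ} {τ ε c : ℝ} (hl : 1 / 2 ≤ lam)
    (hlα : lam < α) (hγ : ∀ u, 0 < γ u ∧ γ u ≤ 1) (hτ : 0 < τ) (hτ1 : τ < 1) (hε : 0 < ε)
    (hεl : ε ≤ lam - 1 / 2) (hc : 0 < c) {n : ℕ} (hn : 2 ≤ n)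
    (hcard : c * (n : ℝ) ^ (1 - ε) ≤ (primeRange n).card)
    {Z : ℕ → Finset (Fin d → ℕ)} (hZ : ∀ p : ℕ, p.Prime → IsGoodSet α γ τ p (Z p))
    (h : Fin d → ℤ) :
    (dualProb n Z h / r α γ h) ^ 2 ≤
      ((2 / (ε * c) + 2 / τ) * V d (α / lam) (weightPow γ (1 / lam)) ^ ε * (n : ℝ) ^ (ε - 1) *
        (4 / (1 - τ) * V d (α / lam) (weightPow γ (1 / lam)) / n) ^ (lam - 1 / 2 - ε)) ^ 2 *
      Set.indicator {h | h ≠ 0} (fun h => 1 / r (α / lam) (weightPow γ (1 / lam)) h) h := by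
  have hγ0 := fun u => (hγ u).1
  have hw := weightPow_pos hγ0 (1 / lam)
  have hl0 : 0 < lam := by linarith
  set v := V d (α / lam) (weightPow γ (1 / lam))
  have hv : 0 ≤ v := V_nonneg hw
  by_cases h0 : dualProb n Z h = 0
  · rw [h0, zero_div, zero_pow two_ne_zero]
    exact mul_nonneg (sq_nonneg _) (Set.indicator_nonneg (fun h _ =>
      one_div_nonneg.2 (r_pos hw h).le) _)
  obtain ⟨p, hp, z, hz, hd⟩ := exists_mem_dual_of_dualProb_ne_zero h0
  rw [Set.indicator_of_mem (s := {h : Fin d → ℤ | h ≠ 0}) hd.1]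
  obtain ⟨j, hj⟩ := Function.ne_iff.1 hd.1
  have hX := (hZ p (prime_of_mem_primeRange hp)).one_div_r_le hl hlα hγ hτ1 hn hp hz hd
  set X := 4 / (1 - τ) * v / n
  set s := r (α / lam) (weightPow γ (1 / lam)) h with hsdef
  have hs : 0 < s := r_pos hw h
  have hrs : r α γ h = s ^ lam := by
    rw [hsdef, div_eq_mul_one_div α lam, r_rpow hγ0, ← Real.rpow_mul (r_pos hγ0 h).le,
      one_div_mul_cancel hl0.ne', Real.rpow_one]
  have hsj : |(h j : ℝ)| ≤ v * s := abs_le_V_mul_r (one_lt_div_of_lt hl hlα)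
    (fun u => ⟨hw u, weightPow_le_one hγ (one_div_nonneg.2 hl0.le) u⟩) hj
  have hK : 0 < 2 / (ε * c) + 2 / τ := by positivity
  set K := 2 / (ε * c) + 2 / τ
  have h1 : dualProb n Z h ≤ K * (v ^ ε * s ^ ε) * (n : ℝ) ^ (ε - 1) := by
    refine (dualProb_le hτ hε hc hn hcard hZ hj).trans ?_
    rw [← Real.mul_rpow hv hs.le]
    gcongr
  -- The factor `s^(-1/2)` is reserved for summation after squaring; the remaining exponent is
  -- nonnegative because `ε ≤ lam - 1/2`, so `1/s ≤ X` applies.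
  have h2 : s ^ ε / s ^ lam ≤ X ^ (lam - 1 / 2 - ε) * (1 / s) ^ (1 / 2 : ℝ) := by
    have : s ^ ε / s ^ lam = (1 / s) ^ (lam - 1 / 2 - ε) * (1 / s) ^ (1 / 2 : ℝ) := by
      rw [← Real.rpow_sub hs, ← Real.rpow_add (by positivity), one_div, Real.inv_rpow hs.le,
        ← Real.rpow_neg hs.le]
      congr 1; ring
    rw [this]
    gcongr
  have h3 : dualProb n Z h / r α γ h ≤
      K * v ^ ε * (n : ℝ) ^ (ε - 1) * X ^ (lam - 1 / 2 - ε) * (1 / s) ^ (1 / 2 : ℝ) := by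
    rw [hrs]
    calc dualProb n Z h / s ^ lam ≤ K * (v ^ ε * s ^ ε) * (n : ℝ) ^ (ε - 1) / s ^ lam := by gcongr
      _ = K * v ^ ε * (n : ℝ) ^ (ε - 1) * (s ^ ε / s ^ lam) := by ring
      _ ≤ K * v ^ ε * (n : ℝ) ^ (ε - 1) * (X ^ (lam - 1 / 2 - ε) * (1 / s) ^ (1 / 2 : ℝ)) := by
          gcongr
      _ = _ := by ring
  refine (pow_le_pow_left₀ (div_nonneg (dualProb_nonneg n Z h) (r_pos hγ0 h).le) h3 2).trans_eq ?_
  rw [mul_pow, ← Real.sqrt_eq_rpow, Real.sq_sqrt (by positivity)]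

theorem expectedError_le_of_isGoodSet {α lam : ℝ} {γ : Finset ℕ → ℝ} {τ ε c : ℝ}
    (hl : 1 / 2 ≤ lam) (hlα : lam < α) (hγ : ∀ u, 0 < γ u ∧ γ u ≤ 1) (hτ : 0 < τ) (hτ1 : τ < 1)
    (hε : 0 < ε) (hεl : ε ≤ lam - 1 / 2) (hc : 0 < c) {n : ℕ} (hn : 2 ≤ n)
    (hcard : c * (n : ℝ) ^ (1 - ε) ≤ (primeRange n).card)
    {Z : ℕ → Finset (Fin d → ℕ)} (hZ : ∀ p : ℕ, p.Prime → IsGoodSet α γ τ p (Z p))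
    {f : (Fin d → ℝ) → ℂ} (hf : MemClass α γ f) :
    expectedError n Z f ≤
      (2 / (ε * c) + 2 / τ) * (4 / (1 - τ)) ^ (lam - 1 / 2 - ε) *
        V d (α / lam) (weightPow γ (1 / lam)) ^ lam * (n : ℝ) ^ (-lam - 1 / 2 + 2 * ε) *
        korobovNorm α γ f := by
  have hγ0 := fun u => (hγ u).1
  have hw := weightPow_pos hγ0 (1 / lam)
  have hl0 : 0 < lam := by linarith
  have hn0 : (0 : ℝ) < n := by positivity
  have h1τ : 0 < 1 - τ := by linarith
  have hbound := dualProb_div_r_sq_le hl hlα hγ hτ hτ1 hε hεl hc hn hcard hZ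
  have hVdef := V_eq_tsum_indicator (d := d) (α / lam) (weightPow γ (1 / lam))
  have hS := (summable_one_div_r_weightPow (d := d) hl hlα hγ).indicator {h | h ≠ 0}
  have hv : 0 ≤ V d (α / lam) (weightPow γ (1 / lam)) := V_nonneg hw
  set v := V d (α / lam) (weightPow γ (1 / lam))
  set M := (2 / (ε * c) + 2 / τ) * v ^ ε * (n : ℝ) ^ (ε - 1) *
    (4 / (1 - τ) * v / n) ^ (lam - 1 / 2 - ε) with hM
  have hM0 : 0 ≤ M := by positivity
  have hs : Summable fun h => (dualProb n Z h / r α γ h) ^ 2 :=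
    (hS.mul_left _).of_nonneg_of_le (fun h => sq_nonneg _) hbound
  have h1 : ∑' h, (dualProb n Z h / r α γ h) ^ 2 ≤ M ^ 2 * v := by
    rw [hVdef, ← tsum_mul_left]
    exact hs.tsum_le_tsum hbound (hS.mul_left _)
  have h2 : √(∑' h, (dualProb n Z h / r α γ h) ^ 2) ≤ M * v ^ (1 / 2 : ℝ) := by
    refine (Real.sqrt_le_sqrt h1).trans_eq ?_
    rw [Real.sqrt_mul (sq_nonneg _), Real.sqrt_sq hM0, Real.sqrt_eq_rpow]
  have h3 : M * v ^ (1 / 2 : ℝ) = (2 / (ε * c) + 2 / τ) * (4 / (1 - τ)) ^ (lam - 1 / 2 - ε) *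
      v ^ lam * (n : ℝ) ^ (-lam - 1 / 2 + 2 * ε) := by
    -- Here `v` may be `0` (for `d = 0`), so exponents are added under nonnegativity.
    have e1 : v ^ lam = v ^ ε * v ^ (lam - 1 / 2 - ε) * v ^ (1 / 2 : ℝ) := by
      rw [← Real.rpow_add_of_nonneg hv hε.le (by linarith),
        ← Real.rpow_add_of_nonneg hv (by linarith) (by norm_num)]
      congr 1; ring
    have e2 : (n : ℝ) ^ (-lam - 1 / 2 + 2 * ε) =
        (n : ℝ) ^ (ε - 1) / (n : ℝ) ^ (lam - 1 / 2 - ε) := by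
      rw [← Real.rpow_sub hn0]; congr 1; ring
    rw [hM, Real.div_rpow (by positivity) hn0.le, Real.mul_rpow (by positivity) hv, e1, e2]
    ring
  refine (hf.expectedError_le n Z).trans
    ((hf.tsum_norm_mul_le hγ0 (dualProb_nonneg n Z) hs).trans ?_)
  rw [← h3, mul_comm]
  exact mul_le_mul_of_nonneg_right h2 (Real.sqrt_nonneg _)

end Korobov

theorem mainTheorem5 :
    (∀ (d : ℕ) (α : ℝ) (γ : Finset ℕ → ℝ) (τ : ℝ) (p : ℕ),
      1 / 2 < α → (∀ u, 0 < γ u ∧ γ u ≤ 1) → 0 < τ → τ < 1 → p.Prime →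
        ∃ Z : Finset (Fin d → ℕ), Korobov.IsGoodSet α γ τ p Z) ∧
    (∀ (lam δ τ : ℝ), 1 / 2 < lam → 0 < δ → δ < min (lam - 1 / 2) 1 → 0 < τ → τ < 1 →
      ∃ C : ℝ, 0 < C ∧
        ∀ (d : ℕ) (α : ℝ) (γ : Finset ℕ → ℝ) (Z : ℕ → Finset (Fin d → ℕ)),
          lam < α → (∀ u, 0 < γ u ∧ γ u ≤ 1) →
          (∀ p : ℕ, p.Prime → Korobov.IsGoodSet α γ τ p (Z p)) →
          ∀ (f : (Fin d → ℝ) → ℂ), Korobov.MemClass α γ f →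
          ∀ n : ℕ, 2 ≤ n →
            4 * Korobov.V d (α / lam) (Korobov.weightPow γ (1 / lam)) / (1 - τ) ≤ (n : ℝ) →
            Korobov.expectedError n Z f ≤
              C * Korobov.V d (α / lam) (Korobov.weightPow γ (1 / lam)) ^ lam *
                (n : ℝ) ^ (-lam - 1 / 2 + δ) * Korobov.korobovNorm α γ f) := by
  refine ⟨fun d α γ τ p hα hγ _ hτ hp => Korobov.exists_isGoodSet d hα hγ hτ hp, ?_⟩
  intro lam δ τ hl hδ hδl hτ hτ1
  have hδ1 := hδl.trans_le (min_le_left _ _)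
  have hδ2 := hδl.trans_le (min_le_right _ _)
  -- The rate loses `ε` twice, through the prime count and through `|h j|^ε`; hence `ε = δ / 2`.
  obtain ⟨c, hc, hcard⟩ := Korobov.exists_card_primeRange_ge (δ / 2) (by linarith) (by linarith)
  have h1τ : 0 < 1 - τ := by linarith
  refine ⟨_, mul_pos (a := 2 / (δ / 2 * c) + 2 / τ) (b := (4 / (1 - τ)) ^ (lam - 1 / 2 - δ / 2))
    (by positivity) (by positivity), fun d α γ Z hlα hγ hZ f hf n hn _ => ?_⟩
  have := Korobov.expectedError_le_of_isGoodSet hl.le hlα hγ hτ hτ1 (ε := δ / 2) (by linarith)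
    (by linarith) hc hn (hcard n hn) hZ hf
  rwa [mul_div_cancel₀ δ two_ne_zero] at this
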